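/- Let $f(x,y,z)=x^3y+y^3z+z^3x$ be the Klein quartic form, and let $\mathrm{PSL}_2(\mathbb F_7)$ act faithfully and linearly on $\mathbb C^3$, by matrices of determinant $1$ that leave $f$ invariant. Let $\alpha,\beta\in\mathbb C[u,v]$ be forms of degree $1$, each with exactly one zero on $\mathbb P^1$, without a common zero. Consider the following complex threefolds. * $\mathcal X_1'\subset\mathbb P^1\times\mathbb P(1,1,1,2)$ is the hypersurface $\alpha(u,v)\,t^2+\beta(u,v)\,f(x,y,z)=0$, where $u,v$ are the coordinates on $\mathbb P^1$ and $x,y,z,t$ are the coordinates of weights $1,1,1,2$ on $\mathbb P(1,1,1,2)$. * $\mathcal X_1$, the Mori fibre space model of $\mathcal X_1'$, is the hypersurface $\alpha(u,v)\beta(u,v)\,t^2+f(x,y,z)=0$ in the toric variety with homogeneous coordinates $u,v,x,y,z,t$ of degrees $(1,0),(1,0),(0,1),(0,1),(0,1),(-1,2)$ and irrelevant ideal $(u,v)\cap(x,y,z,t)$. It is a fibration over $\mathbb P^1_{u:v}$ in del Pezzo surfaces of degree $2$. The group $\mathrm{PSL}_2(\mathbb F_7)$ acts on $\mathcal X_1'$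 and on $\mathcal X_1$ through its action on $x,y,z$, fixing $u,v,t$, and on $\mathbb P^2\times\mathbb P^1$ through its action on $\mathbb P^2=\mathbb P(\mathbb C^3)$ and trivially on $\mathbb P^1$. **Theorem.** The assignment $(u:v;\,x:y:z:t)\mapsto(u:v;\,x:y:z:\beta(u,v)\,t)$ defines a $\mathrm{PSL}_2(\mathbb F_7)$-equivariant birational map $\mathcal X_1\dashrightarrow\mathcal X_1'$, and there is a $\mathrm{PSL}_2(\mathbb F_7)$-equivariant birational map $\mathcal X_1\dashrightarrow\mathbb P^2\times\mathbb P^1$. -/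

import Mathlib

open scoped LinearAlgebra.Projectivization MatrixGroups

noncomputable section

namespace KleinFibration

/-! ### Complex varieties in homogeneous coordinates -/

/-- The Zariski topology on the affine space `σ → ℂ`: the sets `{p | F p ≠ 0}`, for polynomials
`F`, form a base of it. -/
@[reducible] def zariskiTopology (σ : Type) : TopologicalSpace (σ → ℂ) :=
  TopologicalSpace.generateFrom
    {U | ∃ F : MvPolynomial σ ℂ, U = {p | MvPolynomial.eval p F ≠ 0}}

/-- A complex variety (as a set of closed points) presented by homogeneous coordinates: its points
are the images of the points of a subset `cone` of an affine space under a surjective map `toPt`.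
The Zariski topology and the regular functions of the variety are the quotient structure, see
the topology and `CoordVariety.IsRegularOn` below. -/
structure CoordVariety where
  /-- the index set of the homogeneous coordinates -/
  Idx : Type
  /-- the set of admissible coordinate vectors -/
  cone : Set (Idx → ℂ)
  /-- the closed points -/
  Pt : Type
  /-- the point with given homogeneous coordinates -/
  toPt : cone → Pt
  toPt_surjective : Function.Surjective toPt

namespace CoordVariety

/-- The Zariski topology of a variety: a set of points is open when the set of their
homogeneous coordinate vectors is relatively Zariski open in the cone. -/
instance (V : CoordVariety) : TopologicalSpace V.Pt :=
  TopologicalSpace.coinduced V.toPt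
    (TopologicalSpace.induced (Subtype.val : V.cone → V.Idx → ℂ) (zariskiTopology V.Idx))

/-- `φ` is a regular function on the open set `U`: in homogeneous coordinates it is, locally at
every point, a quotient of two polynomials whose denominator does not vanish. -/
def IsRegularOn (V : CoordVariety) (U : Set V.Pt) (φ : V.Pt → ℂ) : Prop :=
  ∀ p : V.cone, V.toPt p ∈ U → ∃ F G : MvPolynomial V.Idx ℂ, MvPolynomial.eval p.1 G ≠ 0 ∧
    ∀ q : V.cone, V.toPt q ∈ U → MvPolynomial.eval q.1 G ≠ 0 →
      φ (V.toPt q) = MvPolynomial.eval q.1 F / MvPolynomial.eval q.1 G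

/-- The continuous map `φ`, defined on the open set `U` of `V`, is a morphism from `U` to `W`: it
pulls back regular functions to regular functions. -/
def IsMorphismOn (V W : CoordVariety) (U : Set V.Pt) (φ : V.Pt → W.Pt) : Prop :=
  ContinuousOn φ U ∧ ∀ (O : Set W.Pt) (h : W.Pt → ℂ), IsOpen O → W.IsRegularOn O h →
    V.IsRegularOn (U ∩ φ ⁻¹' O) (h ∘ φ)

/-- A birational map from `V` to `W`, represented by `e`: an isomorphism of varieties from a
dense open subset of `V` to a dense open subset of `W`. -/
structure IsBirational {V W : CoordVariety} (e : OpenPartialHomeomorph V.Pt W.Pt) : Prop where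
  dense_source : Dense e.source
  dense_target : Dense e.target
  isMorphismOn : IsMorphismOn V W e.source e
  isMorphismOn_symm : IsMorphismOn W V e.target e.symm

/-- The birational map `e` is equivariant for the actions of `H` on `V` and `W` pulled back along
`ρ : G → H`; its domain of definition is chosen `G`-invariant. -/
def IsEquivariant {V W : CoordVariety} {G H : Type*} [Group G] [Group H] [MulAction H V.Pt]
    [MulAction H W.Pt] (ρ : G →* H) (e : OpenPartialHomeomorph V.Pt W.Pt) : Prop :=
  ∀ (g : G), ∀ x ∈ e.source, ρ g • x ∈ e.source ∧ e (ρ g • x) = ρ g • e x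

end CoordVariety

/-! ### The Klein quartic and its group -/

/-- The Klein quartic form `x³y + y³z + z³x`. -/
def kleinQuartic : MvPolynomial (Fin 3) ℂ :=
  .X 0 ^ 3 * .X 1 + .X 1 ^ 3 * .X 2 + .X 2 ^ 3 * .X 0

/-- The group of all unimodular matrices that leave the Klein quartic form invariant. It maps
isomorphically onto the automorphism group of the quartic curve in the projective plane. -/
def kleinGroup : Subgroup SL(3, ℂ) where
  carrier := {A | ∀ p : Fin 3 → ℂ,
    MvPolynomial.eval (A • p) kleinQuartic = MvPolynomial.eval p kleinQuartic}
  one_mem' := by intro p; rw [one_smul]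
  mul_mem' := by
    intro A B hA hB p
    rw [mul_smul, hA, hB]
  inv_mem' := by
    intro A hA p
    rw [← hA, smul_inv_smul]

/-! ### The product of the projective plane and the projective line -/

/-- `ℙ² × ℙ¹`, with its bihomogeneous coordinates. -/
def planeTimesLine : CoordVariety where
  Idx := Fin 3 ⊕ Fin 2
  cone := {p | (fun i => p (Sum.inl i)) ≠ 0 ∧ (fun i => p (Sum.inr i)) ≠ 0}
  Pt := ℙ ℂ (Fin 3 → ℂ) × ℙ ℂ (Fin 2 → ℂ)
  toPt p := (Projectivization.mk ℂ _ p.2.1, Projectivization.mk ℂ _ p.2.2)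
  toPt_surjective := by
    rintro ⟨a, b⟩
    induction a with | h v hv =>
    induction b with | h w hw =>
    exact ⟨⟨Sum.elim v w, hv, hw⟩, rfl⟩

/-- The Klein group acts on the plane, and trivially on the line. -/
instance : MulAction kleinGroup planeTimesLine.Pt where
  smul A x := ((A • x.1 : ℙ ℂ (Fin 3 → ℂ)), x.2)
  one_smul x := Prod.ext (one_smul kleinGroup (x.1 : ℙ ℂ (Fin 3 → ℂ))) rfl
  mul_smul A B x := Prod.ext (mul_smul A B (x.1 : ℙ ℂ (Fin 3 → ℂ))) rfl

/-! ### Threefolds in weighted projective bundles over the line -/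

/-- Indices of the coordinates `u, v`, then `x, y, z`, then `t`. -/
abbrev CoxIdx : Type := Fin 2 ⊕ Fin 3 ⊕ Unit

/-- The vector with coordinates `(u, v) = b`, `(x, y, z) = a`, and `t`. -/
def coxVec (b : Fin 2 → ℂ) (a : Fin 3 → ℂ) (t : ℂ) : CoxIdx → ℂ :=
  Sum.elim b (Sum.elim a fun _ => t)

/-- The coordinates `(u, v)`. -/
def lineCoord (p : CoxIdx → ℂ) : Fin 2 → ℂ := fun i => p (.inl i)

/-- The coordinates `(x, y, z)`. -/
def planeCoord (p : CoxIdx → ℂ) : Fin 3 → ℂ := fun i => p (.inr (.inl i))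

/-- The coordinate `t`. -/
def tCoord (p : CoxIdx → ℂ) : ℂ := p (.inr (.inr ()))

/-- The action of `(l, m)` in the torus `ℂˣ × ℂˣ` for which `u, v` have degree `(1, 0)`,
`x, y, z` have degree `(0, 1)` and `t` has degree `(-n, 2)`. -/
def torusAct (n : ℕ) (l m : ℂˣ) (p : CoxIdx → ℂ) : CoxIdx → ℂ :=
  coxVec ((l : ℂ) • lineCoord p) ((m : ℂ) • planeCoord p)
    ((l : ℂ) ^ (-(n : ℤ)) * (m : ℂ) ^ 2 * tCoord p)

/-- The coordinate vectors with `(u, v) ≠ 0`, `(x, y, z, t) ≠ 0` and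
`a(u, v) t² + b(u, v) f(x, y, z) = 0`, where `f` is the Klein quartic form. -/
def fibrationCone (a b : MvPolynomial (Fin 2) ℂ) : Set (CoxIdx → ℂ) :=
  {p | lineCoord p ≠ 0 ∧ ¬(planeCoord p = 0 ∧ tCoord p = 0) ∧
    MvPolynomial.eval (lineCoord p) a * tCoord p ^ 2 +
      MvPolynomial.eval (lineCoord p) b * MvPolynomial.eval (planeCoord p) kleinQuartic = 0}

/-- Two coordinate vectors represent the same point when they lie in one orbit of the torus. -/
def fibrationSetoid (n : ℕ) (a b : MvPolynomial (Fin 2) ℂ) : Setoid (fibrationCone a b) where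
  r p q := ∃ l m : ℂˣ, q.1 = torusAct n l m p.1
  iseqv := by
    refine ⟨fun p => ⟨1, 1, ?_⟩, ?_, ?_⟩
    · ext (i | i | i) <;> simp [torusAct, coxVec, lineCoord, planeCoord, tCoord]
    · rintro ⟨p, hp⟩ ⟨q, hq⟩ ⟨l, m, h⟩
      refine ⟨l⁻¹, m⁻¹, ?_⟩
      simp only at h ⊢
      subst h
      ext (i | i | i) <;> simp [torusAct, coxVec, lineCoord, planeCoord, tCoord]
      field_simp
    · rintro ⟨p, hp⟩ ⟨q, hq⟩ ⟨r, hr⟩ ⟨l, m, h⟩ ⟨l', m', h'⟩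
      refine ⟨l' * l, m' * m, ?_⟩
      simp only at h h' ⊢
      subst h
      rw [h']
      ext (i | i | i) <;> simp [torusAct, coxVec, lineCoord, planeCoord, tCoord, mul_assoc]
      ring

/-- The hypersurface `a(u, v) t² + b(u, v) f(x, y, z) = 0` in the toric variety with homogeneous
coordinates `u, v, x, y, z, t` of degrees `(1, 0)`, `(1, 0)`, `(0, 1)`, `(0, 1)`, `(0, 1)`,
`(-n, 2)` and irrelevant ideal `(u, v) ∩ (x, y, z, t)`. This toric variety is a bundle over `ℙ¹`
with fibre `ℙ(1, 1, 1, 2)`, and is `ℙ¹ × ℙ(1, 1, 1, 2)` for `n = 0`. -/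
def fibration (n : ℕ) (a b : MvPolynomial (Fin 2) ℂ) : CoordVariety where
  Idx := CoxIdx
  cone := fibrationCone a b
  Pt := Quotient (fibrationSetoid n a b)
  toPt := Quotient.mk _
  toPt_surjective := Quotient.mk_surjective

/-- A matrix acts on the coordinates `x, y, z` and fixes `u, v, t`. -/
def coordAct (A : SL(3, ℂ)) (p : CoxIdx → ℂ) : CoxIdx → ℂ :=
  coxVec (lineCoord p) (A • planeCoord p) (tCoord p)

theorem coordAct_mem {a b : MvPolynomial (Fin 2) ℂ} (A : kleinGroup) {p : CoxIdx → ℂ}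
    (hp : p ∈ fibrationCone a b) : coordAct A p ∈ fibrationCone a b := by
  refine ⟨hp.1, fun h => hp.2.1 ⟨?_, h.2⟩, ?_⟩
  · exact (smul_eq_zero_iff_eq (A : SL(3, ℂ))).1 h.1
  · have h := hp.2.2
    rw [← A.2 (planeCoord p)] at h
    exact h

/-- The Klein group acts on the fibres of the fibration over `ℙ¹`, by its linear action on the
coordinates `x, y, z`. -/
instance (n : ℕ) (a b : MvPolynomial (Fin 2) ℂ) : MulAction kleinGroup (fibration n a b).Pt where
  smul A := Quotient.map (fun p => ⟨coordAct A p.1, coordAct_mem A p.2⟩) (by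
    rintro ⟨p, hp⟩ ⟨q, hq⟩ ⟨l, m, h⟩
    refine ⟨l, m, ?_⟩
    simp only at h ⊢
    subst h
    have h1 := smul_comm (A : SL(3, ℂ)) (m : ℂ) (planeCoord p)
    show coxVec ((l : ℂ) • lineCoord p) ((A : SL(3, ℂ)) • ((m : ℂ) • planeCoord p)) _ = _
    rw [h1]
    rfl)
  one_smul := by
    rintro ⟨p⟩
    refine congrArg (Quotient.mk _) (Subtype.ext ?_)
    show coxVec (lineCoord p.1) ((1 : SL(3, ℂ)) • planeCoord p.1) (tCoord p.1) = p.1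
    rw [one_smul]
    ext (i | i | i) <;> rfl
  mul_smul := by
    rintro A B ⟨p⟩
    refine congrArg (Quotient.mk _) (Subtype.ext ?_)
    show coxVec _ (((A : SL(3, ℂ)) * (B : SL(3, ℂ))) • planeCoord p.1) _ = _
    rw [mul_smul]
    rfl

/-- The hypersurface `α t² + β f = 0` in `ℙ¹ × ℙ(1, 1, 1, 2)`. -/
def singularModel (α β : MvPolynomial (Fin 2) ℂ) : CoordVariety := fibration 0 α β

/-- The Mori fibre space model of `α t² + β f = 0`, for forms `α` and `β` of degree `n`: the
hypersurface `α β t² + f = 0` in the toric variety in which `t` has degree `(-n, 2)`. -/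
def moriModel (n : ℕ) (α β : MvPolynomial (Fin 2) ℂ) : CoordVariety := fibration n (α * β) 1

instance (α β : MvPolynomial (Fin 2) ℂ) : MulAction kleinGroup (singularModel α β).Pt :=
  inferInstanceAs (MulAction kleinGroup (fibration 0 α β).Pt)

instance (n : ℕ) (α β : MvPolynomial (Fin 2) ℂ) : MulAction kleinGroup (moriModel n α β).Pt :=
  inferInstanceAs (MulAction kleinGroup (fibration n (α * β) 1).Pt)

/-- The zero set in `ℙ¹` of a binary form. -/
def zeroSet (α : MvPolynomial (Fin 2) ℂ) : Set (ℙ ℂ (Fin 2 → ℂ)) :=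
  {P | MvPolynomial.eval P.rep α = 0}

/-- `α` and `β` are binary forms of degree `n`, each with `n` distinct zeros on `ℙ¹`, and without
a common zero. -/
structure IsAdmissible (n : ℕ) (α β : MvPolynomial (Fin 2) ℂ) : Prop where
  isHomogeneous_left : α.IsHomogeneous n
  isHomogeneous_right : β.IsHomogeneous n
  encard_left : (zeroSet α).encard = n
  encard_right : (zeroSet β).encard = n
  disjoint : Disjoint (zeroSet α) (zeroSet β)

/-- `e` is given in homogeneous coordinates by `(u : v; x : y : z : t) ↦ (u : v; x : y : z : βt)`
wherever it is defined. -/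
def IsMulBy {n : ℕ} {α β : MvPolynomial (Fin 2) ℂ}
    (e : OpenPartialHomeomorph (moriModel n α β).Pt (singularModel α β).Pt) : Prop :=
  ∀ p : (moriModel n α β).cone, (moriModel n α β).toPt p ∈ e.source →
    ∃ q : (singularModel α β).cone,
      q.1 = coxVec (lineCoord p.1) (planeCoord p.1)
        (MvPolynomial.eval (lineCoord p.1) β * tCoord p.1) ∧
      e ((moriModel n α β).toPt p) = (singularModel α β).toPt q

end KleinFibration

end

noncomputable section

namespace KleinFibration

open scoped Topology

/-! Multiplying `αβt² + f = 0` by `β` gives `α(βt)² + βf = 0`, so `t ↦ βt` carries one hypersurface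
to the other and is invertible where `β ≠ 0`.

For the product, let `K` be the Hessian covariant of `f`, of degree 6. Since `β` has degree `(1,0)`
and `t` degree `(-1,2)`, both `βtf` and `K` have degree `(0,6)`, so `w₀ : w₁ = βtf : K` is a
well-defined rational map to the line. Together with `(x:y:z)` it is birational. Indeed the equation
gives `β/α = -(βt)²/f`, and `βt = w₀K/(w₁f)`, hence `(α:β) = (-f³w₁² : w₀²K²)`, which recovers
`(u:v)` because `α, β` are linear coordinates (`IsAdmissible.exists_dual`). Taking `t = w₀w₁fK` and
scaling `x, y, z` by the same factor then solves the equation. The group fixes `u, v, t` and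
preserves `f`. It also preserves `K`, because the Hessian matrix transforms as a bilinear form under
matrices of determinant 1 (`hessianMatrix_smul`, `eval_kleinHessian_group_smul`). Both maps are
therefore equivariant for all of `kleinGroup`, and so along `ρ`.

Birationality is formal (`CoordVariety.exists_isBirational`) once the loci `β ≠ 0`, `fK ≠ 0` and
`w₀w₁fK ≠ 0` are known to be dense. Irreducibility is not invoked: each point is the value at `0` of
an explicit polynomial curve that generically lies in the open set (`mem_closure_of_curve`). The
delicate points have `t = 0` and `αβ ≠ 0`; there smoothness of the Klein quartic supplies the curve
(`exists_polar_eq`). -/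

/-! ### Polynomial maps between varieties in homogeneous coordinates -/

/-- The polynomial map with components `c`. -/
def polyMap {σ τ : Type} (c : τ → MvPolynomial σ ℂ) (p : σ → ℂ) : τ → ℂ :=
  fun i => MvPolynomial.eval p (c i)

theorem eval_polyMap {σ τ : Type} (c : τ → MvPolynomial σ ℂ) (p : σ → ℂ) (F : MvPolynomial τ ℂ) :
    MvPolynomial.eval (polyMap c p) F = MvPolynomial.eval p (MvPolynomial.bind₁ c F) := by
  rw [← MvPolynomial.coe_aeval_eq_eval, ← MvPolynomial.coe_aeval_eq_eval]
  simp only [RingHom.coe_coe, MvPolynomial.aeval_bind₁]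
  rfl

theorem continuous_polyMap {σ τ : Type} (c : τ → MvPolynomial σ ℂ) :
    @Continuous _ _ (zariskiTopology σ) (zariskiTopology τ) (polyMap c) := by
  refine continuous_generateFrom_iff.2 ?_
  rintro _ ⟨F, rfl⟩
  refine TopologicalSpace.isOpen_generateFrom_of_mem ⟨MvPolynomial.bind₁ c F, ?_⟩
  ext p
  simp [eval_polyMap]

/-- The generating sets are already a base, because the nonvanishing loci of `F` and `G` intersect
in that of `F * G`. -/
theorem exists_eval_ne_zero_of_isOpen {σ : Type} {O : Set (σ → ℂ)} (hO : IsOpen[zariskiTopology σ] O)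
    {p : σ → ℂ} (hp : p ∈ O) :
    ∃ F : MvPolynomial σ ℂ, MvPolynomial.eval p F ≠ 0 ∧
      ∀ q, MvPolynomial.eval q F ≠ 0 → q ∈ O := by
  induction hO with
  | basic s hs =>
    obtain ⟨F, rfl⟩ := hs
    exact ⟨F, hp, fun q hq => hq⟩
  | univ => exact ⟨1, by simp, fun q _ => trivial⟩
  | inter s t _ _ ihs iht =>
    obtain ⟨F, hF, hF'⟩ := ihs hp.1
    obtain ⟨G, hG, hG'⟩ := iht hp.2
    refine ⟨F * G, by simp [hF, hG], fun q hq => ?_⟩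
    rw [map_mul] at hq
    exact ⟨hF' q (left_ne_zero_of_mul hq), hG' q (right_ne_zero_of_mul hq)⟩
  | sUnion S _ ih =>
    obtain ⟨s, hs, hps⟩ := hp
    obtain ⟨F, hF, hF'⟩ := ih s hs hps
    exact ⟨F, hF, fun q hq => ⟨s, hs, hF' q hq⟩⟩

theorem eval_curve {σ : Type} (c : σ → Polynomial ℂ) (s : ℂ) (F : MvPolynomial σ ℂ) :
    (MvPolynomial.aeval c F).eval s = MvPolynomial.eval (fun i => (c i).eval s) F := by
  induction F using MvPolynomial.induction_on with
  | C a => simp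
  | add F G hF hG => simp [hF, hG]
  | mul_X F i hF => simp [hF]

/-! ### Open sets in homogeneous coordinates, and closures along curves. -/

namespace CoordVariety

variable {V W : CoordVariety}

theorem isOpen_iff (U : Set V.Pt) : IsOpen U ↔
    ∃ O : Set (V.Idx → ℂ), IsOpen[zariskiTopology V.Idx] O ∧
      ∀ p : V.cone, V.toPt p ∈ U ↔ p.1 ∈ O := by
  rw [isOpen_coinduced]
  constructor
  · rintro ⟨O, hO, h⟩
    exact ⟨O, hO, fun p => (Set.ext_iff.1 h p).symm⟩
  · rintro ⟨O, hO, h⟩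
    exact ⟨O, hO, Set.ext fun p => (h p).symm⟩

/-- The set of the points with homogeneous coordinates at which `F` does not vanish. -/
def basicOpen (V : CoordVariety) (F : MvPolynomial V.Idx ℂ) : Set V.Pt :=
  {x | ∃ p : V.cone, V.toPt p = x ∧ MvPolynomial.eval p.1 F ≠ 0}

/-- The vanishing of `F` does not depend on the choice of homogeneous coordinates. -/
def IsSemiInvariant (V : CoordVariety) (F : MvPolynomial V.Idx ℂ) : Prop :=
  ∀ p q : V.cone, V.toPt p = V.toPt q → MvPolynomial.eval p.1 F ≠ 0 → MvPolynomial.eval q.1 F ≠ 0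

theorem IsSemiInvariant.toPt_mem_basicOpen {F : MvPolynomial V.Idx ℂ} (hF : V.IsSemiInvariant F)
    (p : V.cone) : V.toPt p ∈ V.basicOpen F ↔ MvPolynomial.eval p.1 F ≠ 0 :=
  ⟨fun ⟨q, hq, h⟩ => hF q p hq h, fun h => ⟨p, rfl, h⟩⟩

theorem IsSemiInvariant.isOpen_basicOpen {F : MvPolynomial V.Idx ℂ} (hF : V.IsSemiInvariant F) :
    IsOpen (V.basicOpen F) :=
  (isOpen_iff _).2 ⟨{p | MvPolynomial.eval p F ≠ 0},
    TopologicalSpace.isOpen_generateFrom_of_mem ⟨F, rfl⟩, hF.toPt_mem_basicOpen⟩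

/-- A polynomial curve in homogeneous coordinates that generically lies over `S` has all its points
in the closure of `S`. -/
theorem mem_closure_of_curve {S : Set V.Pt} (p : V.cone) (c : V.Idx → Polynomial ℂ)
    (hc : ∀ i, (c i).eval 0 = p.1 i) (Q : Polynomial ℂ) (hQ : Q ≠ 0)
    (hS : ∀ s, Q.eval s ≠ 0 → ∃ h : (fun i => (c i).eval s) ∈ V.cone, V.toPt ⟨_, h⟩ ∈ S) :
    V.toPt p ∈ closure S := by
  rw [mem_closure_iff]
  intro O hO hp
  obtain ⟨O', hO', h⟩ := (isOpen_iff O).1 hO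
  obtain ⟨F, hF, hF'⟩ := exists_eval_ne_zero_of_isOpen hO' ((h p).1 hp)
  -- Along the curve `F` becomes a polynomial in one variable that is nonzero at `0`. Its product
  -- with `Q` is nonzero too, so it has a nonvanishing value over the infinite field `ℂ`.
  have hF0 : MvPolynomial.aeval c F ≠ 0 := by
    intro h0
    apply hF
    have := eval_curve c 0 F
    rw [h0, funext hc] at this
    simpa using this.symm
  obtain ⟨s, hs⟩ : ∃ s, (MvPolynomial.aeval c F * Q).eval s ≠ 0 := by
    by_contra! hall
    exact mul_ne_zero hF0 hQ (Polynomial.funext (by simpa using hall))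
  rw [Polynomial.eval_mul] at hs
  obtain ⟨hm, hmS⟩ := hS s (right_ne_zero_of_mul hs)
  refine ⟨_, (h ⟨_, hm⟩).2 (hF' _ ?_), hmS⟩
  rw [← eval_curve]
  exact left_ne_zero_of_mul hs

/-- The polynomial map with components `c` induces a map from the open set `F ≠ 0` of `V` to the
open set `G ≠ 0` of `W`. -/
structure Induces (V W : CoordVariety) (c : W.Idx → MvPolynomial V.Idx ℂ)
    (F : MvPolynomial V.Idx ℂ) (G : MvPolynomial W.Idx ℂ) : Prop where
  isSemiInvariant : V.IsSemiInvariant F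
  mem_cone : ∀ p : V.cone, MvPolynomial.eval p.1 F ≠ 0 → polyMap c p.1 ∈ W.cone
  eval_ne_zero : ∀ p : V.cone, MvPolynomial.eval p.1 F ≠ 0 →
    MvPolynomial.eval (polyMap c p.1) G ≠ 0
  congr : ∀ (p q : V.cone) (hp : polyMap c p.1 ∈ W.cone) (hq : polyMap c q.1 ∈ W.cone),
    MvPolynomial.eval p.1 F ≠ 0 → V.toPt p = V.toPt q → W.toPt ⟨_, hp⟩ = W.toPt ⟨_, hq⟩

/-! ### Morphisms induced by polynomial maps of cones. -/

namespace Induces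

variable {c : W.Idx → MvPolynomial V.Idx ℂ} {F : MvPolynomial V.Idx ℂ} {G : MvPolynomial W.Idx ℂ}

theorem exists_map [Nonempty W.Pt] (h : Induces V W c F G) :
    ∃ φ : V.Pt → W.Pt, ∀ (p : V.cone) (hp : MvPolynomial.eval p.1 F ≠ 0),
      φ (V.toPt p) = W.toPt ⟨_, h.mem_cone p hp⟩ := by
  have key : ∀ x : V.Pt, ∃ y : W.Pt, ∀ (p : V.cone) (hp : MvPolynomial.eval p.1 F ≠ 0),
      V.toPt p = x → y = W.toPt ⟨_, h.mem_cone p hp⟩ := by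
    intro x
    by_cases hx : x ∈ V.basicOpen F
    · obtain ⟨q, rfl, hq⟩ := hx
      exact ⟨_, fun p hp hpq => h.congr q p (h.mem_cone q hq) _ hq hpq.symm⟩
    -- Outside the locus `F ≠ 0` the value is arbitrary; only the restriction to that locus is used.
    · exact ⟨Classical.arbitrary _, fun p hp hpx => (hx ⟨p, hpx, hp⟩).elim⟩
  choose φ hφ using key
  exact ⟨φ, fun p hp => hφ _ p hp rfl⟩

/-- Both conditions can be tested on the cones: polynomial maps are Zariski continuous there, and
substituting the components `c` into a local fraction of polynomials gives again such a fraction. -/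
theorem isMorphismOn (h : Induces V W c F G) {φ : V.Pt → W.Pt}
    (hφ : ∀ (p : V.cone) (hp : MvPolynomial.eval p.1 F ≠ 0),
      φ (V.toPt p) = W.toPt ⟨_, h.mem_cone p hp⟩) :
    IsMorphismOn V W (V.basicOpen F) φ := by
  have hU := h.isSemiInvariant.toPt_mem_basicOpen
  refine ⟨?_, ?_⟩
  · rw [continuousOn_open_iff h.isSemiInvariant.isOpen_basicOpen]
    intro O hO
    obtain ⟨O', hO', hmem⟩ := (isOpen_iff O).1 hO
    refine (isOpen_iff _).2 ⟨{p | MvPolynomial.eval p F ≠ 0} ∩ polyMap c ⁻¹' O', ?_, ?_⟩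
    · exact @IsOpen.inter _ (zariskiTopology V.Idx) _ _
        (TopologicalSpace.isOpen_generateFrom_of_mem ⟨F, rfl⟩)
        (@IsOpen.preimage _ _ (zariskiTopology V.Idx) (zariskiTopology W.Idx) _
          (continuous_polyMap c) _ hO')
    · intro p
      rw [Set.mem_inter_iff, hU]
      refine and_congr_right fun hp => ?_
      rw [Set.mem_preimage, hφ p hp, hmem]
      rfl
  · intro O k _ hk p hp
    have hpF := (hU p).1 hp.1
    have hpO := hp.2
    rw [Set.mem_preimage, hφ p hpF] at hpO
    obtain ⟨A, B, hB, hAB⟩ := hk _ hpO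
    refine ⟨MvPolynomial.bind₁ c A, MvPolynomial.bind₁ c B, by rwa [← eval_polyMap], ?_⟩
    intro q hq hqB
    have hqF := (hU q).1 hq.1
    have hqO := hq.2
    rw [Set.mem_preimage, hφ q hqF] at hqO
    rw [← eval_polyMap] at hqB
    rw [Function.comp_apply, hφ q hqF, hAB _ hqO hqB, eval_polyMap, eval_polyMap]

end Induces

/-- Two polynomial maps that induce mutually inverse maps between dense open sets define a
birational map. -/
theorem exists_isBirational [Nonempty V.Pt] [Nonempty W.Pt]
    {c : W.Idx → MvPolynomial V.Idx ℂ} {d : V.Idx → MvPolynomial W.Idx ℂ}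
    {F : MvPolynomial V.Idx ℂ} {G : MvPolynomial W.Idx ℂ}
    (hc : Induces V W c F G) (hd : Induces W V d G F)
    (hdc : ∀ (p : V.cone) (h : polyMap d (polyMap c p.1) ∈ V.cone),
      MvPolynomial.eval p.1 F ≠ 0 → V.toPt ⟨_, h⟩ = V.toPt p)
    (hcd : ∀ (q : W.cone) (h : polyMap c (polyMap d q.1) ∈ W.cone),
      MvPolynomial.eval q.1 G ≠ 0 → W.toPt ⟨_, h⟩ = W.toPt q)
    (hF : Dense (V.basicOpen F)) (hG : Dense (W.basicOpen G)) :
    ∃ e : OpenPartialHomeomorph V.Pt W.Pt, IsBirational e ∧ e.source = V.basicOpen F ∧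
      ∀ (p : V.cone) (hp : MvPolynomial.eval p.1 F ≠ 0),
        e (V.toPt p) = W.toPt ⟨_, hc.mem_cone p hp⟩ := by
  obtain ⟨φ, hφ⟩ := hc.exists_map
  obtain ⟨ψ, hψ⟩ := hd.exists_map
  have hφm := hc.isMorphismOn hφ
  have hψm := hd.isMorphismOn hψ
  have map_source : ∀ x ∈ V.basicOpen F, φ x ∈ W.basicOpen G := by
    rintro _ ⟨p, rfl, hp⟩
    exact ⟨⟨_, hc.mem_cone p hp⟩, (hφ p hp).symm, hc.eval_ne_zero p hp⟩
  have map_target : ∀ x ∈ W.basicOpen G, ψ x ∈ V.basicOpen F := by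
    rintro _ ⟨p, rfl, hp⟩
    exact ⟨⟨_, hd.mem_cone p hp⟩, (hψ p hp).symm, hd.eval_ne_zero p hp⟩
  have left_inv : ∀ x ∈ V.basicOpen F, ψ (φ x) = x := by
    rintro _ ⟨p, rfl, hp⟩
    rw [hφ p hp, hψ ⟨_, hc.mem_cone p hp⟩ (hc.eval_ne_zero p hp)]
    exact hdc p _ hp
  have right_inv : ∀ x ∈ W.basicOpen G, φ (ψ x) = x := by
    rintro _ ⟨p, rfl, hp⟩
    rw [hψ p hp, hφ ⟨_, hd.mem_cone p hp⟩ (hd.eval_ne_zero p hp)]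
    exact hcd p _ hp
  let e : OpenPartialHomeomorph V.Pt W.Pt :=
    { toFun := φ, invFun := ψ, source := V.basicOpen F, target := W.basicOpen G,
      map_source' := map_source, map_target' := map_target,
      left_inv' := left_inv, right_inv' := right_inv,
      open_source := hc.isSemiInvariant.isOpen_basicOpen,
      open_target := hd.isSemiInvariant.isOpen_basicOpen,
      continuousOn_toFun := hφm.1, continuousOn_invFun := hψm.1 }
  exact ⟨e, ⟨hF, hG, hφm, hψm⟩, rfl, hφ⟩

end CoordVariety

/-! ### The Hessian of the Klein quartic -/

theorem eval_kleinQuartic (p : Fin 3 → ℂ) : MvPolynomial.eval p kleinQuartic =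
    p 0 ^ 3 * p 1 + p 1 ^ 3 * p 2 + p 2 ^ 3 * p 0 := by
  simp [kleinQuartic]

theorem eval_kleinQuartic_smul (m : ℂ) (p : Fin 3 → ℂ) :
    MvPolynomial.eval (m • p) kleinQuartic = m ^ 4 * MvPolynomial.eval p kleinQuartic := by
  simp only [eval_kleinQuartic, Pi.smul_apply, smul_eq_mul]
  ring

/-- The Hessian covariant of the Klein quartic form, up to a constant factor. -/
def kleinHessian : MvPolynomial (Fin 3) ℂ :=
  .X 0 * .X 1 ^ 5 + .X 1 * .X 2 ^ 5 + .X 2 * .X 0 ^ 5 - 5 * (.X 0 ^ 2 * .X 1 ^ 2 * .X 2 ^ 2)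

theorem eval_kleinHessian (p : Fin 3 → ℂ) : MvPolynomial.eval p kleinHessian =
    p 0 * p 1 ^ 5 + p 1 * p 2 ^ 5 + p 2 * p 0 ^ 5 - 5 * (p 0 ^ 2 * p 1 ^ 2 * p 2 ^ 2) := by
  simp [kleinHessian]

theorem eval_kleinHessian_smul (m : ℂ) (p : Fin 3 → ℂ) :
    MvPolynomial.eval (m • p) kleinHessian = m ^ 6 * MvPolynomial.eval p kleinHessian := by
  simp only [eval_kleinHessian, Pi.smul_apply, smul_eq_mul]
  ring

/-- The matrix of second derivatives of the Klein quartic form. -/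
def hessianMatrix (p : Fin 3 → ℂ) : Matrix (Fin 3) (Fin 3) ℂ :=
  !![6 * p 0 * p 1, 3 * p 0 ^ 2, 3 * p 2 ^ 2;
    3 * p 0 ^ 2, 6 * p 1 * p 2, 3 * p 1 ^ 2;
    3 * p 2 ^ 2, 3 * p 1 ^ 2, 6 * p 2 * p 0]

theorem det_hessianMatrix (p : Fin 3 → ℂ) :
    (hessianMatrix p).det = -54 * MvPolynomial.eval p kleinHessian := by
  rw [eval_kleinHessian, Matrix.det_fin_three]
  simp [hessianMatrix]
  ring

/-- The second polar of the Klein quartic form, as a combination of values of the form. -/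
theorem hessianMatrix_polar (p q w : Fin 3 → ℂ) :
    -- The alternating sums keep only the terms odd in both `q` and `w`: those of type `p²qw`, and
    -- those of bidegree `(3,1)` or `(1,3)` in `q, w`. Doubling `q` and `w` multiplies the former by
    -- 4 and the latter by 16, so the combination kills the latter and leaves `4 * (16 - 4) = 48`.
    48 * (q ⬝ᵥ (hessianMatrix p).mulVec w) =
      16 * (MvPolynomial.eval (p + q + w) kleinQuartic
        - MvPolynomial.eval (p + q - w) kleinQuartic
        - MvPolynomial.eval (p - q + w) kleinQuartic
        + MvPolynomial.eval (p - q - w) kleinQuartic)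
      - (MvPolynomial.eval (p + (2 : ℂ) • q + (2 : ℂ) • w) kleinQuartic
        - MvPolynomial.eval (p + (2 : ℂ) • q - (2 : ℂ) • w) kleinQuartic
        - MvPolynomial.eval (p - (2 : ℂ) • q + (2 : ℂ) • w) kleinQuartic
        + MvPolynomial.eval (p - (2 : ℂ) • q - (2 : ℂ) • w) kleinQuartic) := by
  simp only [eval_kleinQuartic, Pi.add_apply, Pi.sub_apply, Pi.smul_apply, smul_eq_mul,
    hessianMatrix, Matrix.mulVec, dotProduct, Fin.sum_univ_three, Matrix.of_apply,
    Matrix.cons_val_zero, Matrix.cons_val_one, Matrix.cons_val]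
  ring

/-- By `hessianMatrix_polar` the Hessian bilinear form is a combination of values of `f` at linear
combinations of `p, q, w`, and `A` commutes with these combinations and preserves the values. No
differentiation is needed. -/
theorem hessianMatrix_smul (A : kleinGroup) (p : Fin 3 → ℂ) :
    (A : SL(3, ℂ)).1.transpose * hessianMatrix ((A : SL(3, ℂ)) • p) * (A : SL(3, ℂ)).1 =
      hessianMatrix p := by
  have key : ∀ q w : Fin 3 → ℂ, ((A : SL(3, ℂ)) • q) ⬝ᵥ
      (hessianMatrix ((A : SL(3, ℂ)) • p)).mulVec ((A : SL(3, ℂ)) • w) =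
      q ⬝ᵥ (hessianMatrix p).mulVec w := by
    intro q w
    have h48 : (48 : ℂ) ≠ 0 := by norm_num
    refine mul_left_cancel₀ h48 ?_
    rw [hessianMatrix_polar, hessianMatrix_polar]
    simp only [← smul_comm (A : SL(3, ℂ)) (2 : ℂ), ← smul_add, ← smul_sub, A.2 _]
  ext i j
  have h := key (Pi.single i 1) (Pi.single j 1)
  have hsm : ∀ v : Fin 3 → ℂ, (A : SL(3, ℂ)) • v = (A : SL(3, ℂ)).1.mulVec v := fun v => rfl
  rw [hsm (Pi.single i 1), hsm (Pi.single j 1), ← Matrix.vecMul_transpose,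
    Matrix.mulVec_mulVec, ← Matrix.dotProduct_mulVec, Matrix.mulVec_mulVec, ← Matrix.mul_assoc] at h
  simpa using h

theorem eval_kleinHessian_group_smul (A : kleinGroup) (p : Fin 3 → ℂ) :
    MvPolynomial.eval ((A : SL(3, ℂ)) • p) kleinHessian = MvPolynomial.eval p kleinHessian := by
  have h := congrArg Matrix.det (hessianMatrix_smul A p)
  rw [Matrix.det_mul, Matrix.det_mul, Matrix.det_transpose, (A : SL(3, ℂ)).2,
    det_hessianMatrix, det_hessianMatrix] at h
  linear_combination (-1 / 54 : ℂ) * h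

/-- This is the smoothness of the Klein quartic: the gradient of `f` vanishes only at the origin, so
elsewhere the directional derivative takes every value. -/
theorem exists_polar_eq {p : Fin 3 → ℂ} (hp : p ≠ 0) (k : ℂ) : ∃ q : Fin 3 → ℂ,
    (3 * p 0 ^ 2 * p 1 + p 2 ^ 3) * q 0 + (p 0 ^ 3 + 3 * p 1 ^ 2 * p 2) * q 1 +
      (p 1 ^ 3 + 3 * p 2 ^ 2 * p 0) * q 2 = k := by
  by_cases h0 : 3 * p 0 ^ 2 * p 1 + p 2 ^ 3 = 0
  · by_cases h1 : p 0 ^ 3 + 3 * p 1 ^ 2 * p 2 = 0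
    · by_cases h2 : p 1 ^ 3 + 3 * p 2 ^ 2 * p 0 = 0
      · refine (hp ?_).elim
        -- At a critical point `z³ = -3x²y`, `x³ = -3y²z` and `y³ = -3z²x`; multiplying these gives
        -- `(xyz)³ = -27(xyz)³`.
        have h : (28 : ℂ) * (p 0 * p 1 * p 2) ^ 3 = 0 := by
          linear_combination (p 0 ^ 3 * p 1 ^ 3) * h0
            - (3 * p 0 ^ 2 * p 1 * p 1 ^ 3) * h1 + (9 * p 0 ^ 2 * p 1 ^ 3 * p 2) * h2
        have h' : p 0 * p 1 * p 2 = 0 := by simpa using h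
        have e0 : p 0 = 0 ∧ p 1 = 0 ∧ p 2 = 0 := by
          rcases mul_eq_zero.1 h' with h' | h'
          · rcases mul_eq_zero.1 h' with h' | h' <;> simp_all
          · simp_all
        ext i
        fin_cases i
        exacts [e0.1, e0.2.1, e0.2.2]
      · exact ⟨![0, 0, k / (p 1 ^ 3 + 3 * p 2 ^ 2 * p 0)], by simp; field_simp⟩
    · exact ⟨![0, k / (p 0 ^ 3 + 3 * p 1 ^ 2 * p 2), 0], by simp; field_simp⟩
  · exact ⟨![k / (3 * p 0 ^ 2 * p 1 + p 2 ^ 3), 0, 0], by simp; field_simp⟩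

/-! ### Linear coordinates on the line -/

theorem exists_eval_eq_of_isHomogeneous_one {α : MvPolynomial (Fin 2) ℂ}
    (hα : α.IsHomogeneous 1) :
    ∃ a b : ℂ, ∀ w, MvPolynomial.eval w α = a * w 0 + b * w 1 := by
  have h := (MvPolynomial.mem_homogeneousSubmodule 1 α).2 hα
  rw [MvPolynomial.homogeneousSubmodule_one_eq_span_X, Submodule.mem_span_range_iff_exists_fun] at h
  obtain ⟨c, rfl⟩ := h
  exact ⟨c 0, c 1, fun w => by simp [Fin.sum_univ_two, MvPolynomial.smul_eval]⟩

theorem IsAdmissible.eval_smul_right {α β : MvPolynomial (Fin 2) ℂ} (h : IsAdmissible 1 α β)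
    (l : ℂ) (w : Fin 2 → ℂ) :
    MvPolynomial.eval (l • w) β = l * MvPolynomial.eval w β := by
  obtain ⟨a, b, hab⟩ := exists_eval_eq_of_isHomogeneous_one h.isHomogeneous_right
  simp only [hab, Pi.smul_apply, smul_eq_mul]
  ring

/-- `r` and `s` are the dual coordinates of the linear forms `α` and `β`. -/
structure IsDual (α β : MvPolynomial (Fin 2) ℂ) (r s : Fin 2 → ℂ) : Prop where
  eval_left : ∀ x y : ℂ, MvPolynomial.eval (x • r + y • s) α = x
  eval_right : ∀ x y : ℂ, MvPolynomial.eval (x • r + y • s) β = y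
  eq : ∀ w, MvPolynomial.eval w α • r + MvPolynomial.eval w β • s = w

/-- The forms `α` and `β` are linear coordinates on the plane over the line, with dual
coordinates `r` and `s`. -/
theorem IsAdmissible.exists_dual {α β : MvPolynomial (Fin 2) ℂ} (h : IsAdmissible 1 α β) :
    ∃ r s : Fin 2 → ℂ, IsDual α β r s := by
  obtain ⟨a, b, hab⟩ := exists_eval_eq_of_isHomogeneous_one h.isHomogeneous_left
  obtain ⟨c, d, hcd⟩ := exists_eval_eq_of_isHomogeneous_one h.isHomogeneous_right
  -- If the determinant vanished, `(b : -a)` would be a common zero. This needs `α` to be nonzero,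
  -- and `α = 0` is excluded since it would vanish at the zero of `β`.
  have hD : a * d - b * c ≠ 0 := by
    intro hD
    have hα0 : ¬(a = 0 ∧ b = 0) := by
      rintro ⟨rfl, rfl⟩
      obtain ⟨P, hP⟩ : (zeroSet β).Nonempty := by
        rw [← Set.encard_ne_zero, h.encard_right]
        simp
      exact Set.disjoint_left.1 h.disjoint (by simp [zeroSet, hab]) hP
    have hv : ![b, -a] ≠ 0 := by
      intro h0
      have h1 := congrFun h0 0
      have h2 := congrFun h0 1
      simp at h1 h2
      exact hα0 ⟨h2, h1⟩
    obtain ⟨k, hk⟩ := Projectivization.exists_smul_eq_mk_rep ℂ ![b, -a] hv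
    have hdisj := Set.disjoint_left.1 h.disjoint
    refine @hdisj (Projectivization.mk ℂ ![b, -a] hv) ?_ ?_
    · simp only [zeroSet, Set.mem_ofPred_eq, ← hk, hab]
      simp [Units.smul_def]
      ring
    · simp only [zeroSet, Set.mem_ofPred_eq, ← hk, hcd]
      simp [Units.smul_def]
      linear_combination (-(k : ℂ)) * hD
  obtain ⟨k, hk⟩ : ∃ k, (a * d - b * c) * k = 1 := ⟨_, mul_inv_cancel₀ hD⟩
  refine ⟨![d * k, -c * k], ![-b * k, a * k], ⟨fun x y => ?_, fun x y => ?_, fun w => ?_⟩⟩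
  · simp [hab]
    linear_combination x * hk
  · simp [hcd]
    linear_combination y * hk
  · ext i
    fin_cases i
    · simp [hab, hcd]
      linear_combination w 0 * hk
    · simp [hab, hcd]
      linear_combination w 1 * hk

theorem IsDual.left_or_right_ne_zero {α β : MvPolynomial (Fin 2) ℂ} {r s : Fin 2 → ℂ}
    (h : IsDual α β r s) {w : Fin 2 → ℂ} (hw : w ≠ 0) :
    MvPolynomial.eval w α ≠ 0 ∨ MvPolynomial.eval w β ≠ 0 := by
  by_contra! h0
  apply hw
  rw [← h.eq w, h0.1, h0.2]
  simp

theorem IsDual.ne_zero_of_left {α β : MvPolynomial (Fin 2) ℂ} {r s : Fin 2 → ℂ}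
    (h : IsDual α β r s) {x y : ℂ} (hx : x ≠ 0) : x • r + y • s ≠ 0 := by
  intro h0
  have h1 := h.eval_left x y
  have h2 := h.eval_left 0 0
  rw [h0] at h1
  simp only [zero_smul, add_zero] at h2
  exact hx (h1.symm.trans h2)

/-! ### Coordinates on the fibrations -/

theorem coxVec_coords (p : CoxIdx → ℂ) :
    coxVec (lineCoord p) (planeCoord p) (tCoord p) = p := by
  ext (i | i | i) <;> rfl

theorem eval_rename_line (p : CoxIdx → ℂ) (α : MvPolynomial (Fin 2) ℂ) :
    MvPolynomial.eval p (MvPolynomial.rename Sum.inl α) = MvPolynomial.eval (lineCoord p) α := by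
  rw [MvPolynomial.eval_rename]
  rfl

theorem eval_rename_plane (p : CoxIdx → ℂ) (F : MvPolynomial (Fin 3) ℂ) :
    MvPolynomial.eval p (MvPolynomial.rename (Sum.inr ∘ Sum.inl) F) =
      MvPolynomial.eval (planeCoord p) F := by
  rw [MvPolynomial.eval_rename]
  rfl

theorem coxVec_mem_fibrationCone {a b : MvPolynomial (Fin 2) ℂ} {w : Fin 2 → ℂ} {x : Fin 3 → ℂ}
    {t : ℂ} (hw : w ≠ 0) (hx : x ≠ 0)
    (h : MvPolynomial.eval w a * t ^ 2 + MvPolynomial.eval w b * MvPolynomial.eval x kleinQuartic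
      = 0) : coxVec w x t ∈ fibrationCone a b :=
  ⟨hw, fun h0 => hx h0.1, h⟩

theorem fibration_toPt_eq_iff {n : ℕ} {a b : MvPolynomial (Fin 2) ℂ} (p q : fibrationCone a b) :
    (fibration n a b).toPt p = (fibration n a b).toPt q ↔
      ∃ l m : ℂˣ, q.1 = torusAct n l m p.1 :=
  Quotient.eq (r := fibrationSetoid n a b)

instance (n : ℕ) (a b : MvPolynomial (Fin 2) ℂ) : Nonempty (fibration n a b).Pt :=
  ⟨(fibration n a b).toPt ⟨coxVec ![1, 0] ![1, 0, 0] 0,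
    coxVec_mem_fibrationCone (fun h => one_ne_zero (congrFun h 0))
      (fun h => one_ne_zero (congrFun h 0)) (by simp [eval_kleinQuartic])⟩⟩

instance : Nonempty planeTimesLine.Pt :=
  ⟨planeTimesLine.toPt ⟨1, fun h => one_ne_zero (congrFun h 0), fun h => one_ne_zero (congrFun h 0)⟩⟩

theorem planeTimesLine_toPt_eq_iff (p q : planeTimesLine.cone) :
    planeTimesLine.toPt p = planeTimesLine.toPt q ↔
      (∃ m : ℂˣ, m • (fun i => p.1 (Sum.inl i)) = fun i => q.1 (Sum.inl i)) ∧
      ∃ l : ℂˣ, l • (fun i => p.1 (Sum.inr i)) = fun i => q.1 (Sum.inr i) := by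
  rw [eq_comm]
  refine Prod.ext_iff.trans (and_congr ?_ ?_)
  · exact Projectivization.mk_eq_mk_iff ℂ _ _ _ _
  · exact Projectivization.mk_eq_mk_iff ℂ _ _ _ _

/-! ### Density -/

section Density

variable {n : ℕ} {a b α β : MvPolynomial (Fin 2) ℂ} {r s : Fin 2 → ℂ}

/-- The curve moves the base point through its values `A, B` of `α, β` instead of `u, v`. This way
the equation of the threefold can be solved for one of these values. -/
theorem fibration_mem_closure_of_curve (h : IsDual α β r s) {S : Set (fibration n a b).Pt}
    (p : fibrationCone a b) (A B : Polynomial ℂ) (x : Fin 3 → Polynomial ℂ) (t : Polynomial ℂ)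
    (hA : A.eval 0 = MvPolynomial.eval (lineCoord p.1) α)
    (hB : B.eval 0 = MvPolynomial.eval (lineCoord p.1) β)
    (hx : ∀ i, (x i).eval 0 = planeCoord p.1 i) (ht : t.eval 0 = tCoord p.1)
    (heq : ∀ z, MvPolynomial.eval (A.eval z • r + B.eval z • s) a * t.eval z ^ 2 +
      MvPolynomial.eval (A.eval z • r + B.eval z • s) b *
        MvPolynomial.eval (fun i => (x i).eval z) kleinQuartic = 0)
    (Q : Polynomial ℂ) (hQ : Q ≠ 0)
    (hS : ∀ z (hz : coxVec (A.eval z • r + B.eval z • s) (fun i => (x i).eval z) (t.eval z) ∈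
      fibrationCone a b), Q.eval z ≠ 0 → (fibration n a b).toPt ⟨_, hz⟩ ∈ S) :
    (fibration n a b).toPt p ∈ closure S := by
  let c : CoxIdx → Polynomial ℂ :=
    Sum.elim (fun i => A * .C (r i) + B * .C (s i)) (Sum.elim x fun _ => t)
  have hcz : ∀ z, (fun i => (c i).eval z) =
      coxVec (A.eval z • r + B.eval z • s) (fun i => (x i).eval z) (t.eval z) := by
    intro z
    ext (i | i | i) <;> simp [c, coxVec]
  have hc0 : (fun i => (c i).eval 0) = p.1 := by
    rw [hcz, hA, hB, h.eq, ht, funext hx]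
    exact coxVec_coords p.1
  have hne : ∀ i, p.1 i ≠ 0 → c i ≠ 0 := by
    intro i hi h0
    apply hi
    rw [← hc0]
    simp [h0]
  -- One coordinate is chosen in each block of the irrelevant ideal. Where neither of them vanishes,
  -- the curve avoids the irrelevant locus, so their product is absorbed into `Q`.
  obtain ⟨i, hi⟩ : ∃ i, p.1 (Sum.inl i) ≠ 0 := by
    by_contra! h0
    exact p.2.1 (funext h0)
  obtain ⟨j, hj⟩ : ∃ j, p.1 (Sum.inr j) ≠ 0 := by
    by_contra! h0
    exact p.2.2.1 ⟨funext fun k => h0 (.inl k), h0 (.inr ())⟩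
  refine CoordVariety.mem_closure_of_curve (V := fibration n a b) p c (congrFun hc0)
    (Q * (c (.inl i) * c (.inr j))) (mul_ne_zero hQ (mul_ne_zero (hne _ hi) (hne _ hj))) ?_
  intro z hz
  simp only [Polynomial.eval_mul] at hz
  have hz1 := left_ne_zero_of_mul (right_ne_zero_of_mul hz)
  have hz2 := right_ne_zero_of_mul (right_ne_zero_of_mul hz)
  have hmem : (fun i => (c i).eval z) ∈ fibrationCone a b := by
    refine ⟨fun h0 => hz1 (congrFun h0 i), fun h0 => hz2 ?_, ?_⟩
    · rcases j with j | j
      · exact congrFun h0.1 j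
      · exact h0.2
    · rw [hcz]
      exact heq z
  refine ⟨hmem, ?_⟩
  have hmem' := hmem
  rw [hcz] at hmem'
  have hres := hS z hmem' (left_ne_zero_of_mul hz)
  convert hres using 2
  exact Subtype.ext (hcz z)

theorem dense_moriModel_tCoord_ne_zero (h : IsDual α β r s) :
    Dense {P : (moriModel n α β).Pt | ∃ q : (moriModel n α β).cone,
      (moriModel n α β).toPt q = P ∧ tCoord q.1 ≠ 0} := by
  intro P
  obtain ⟨p, rfl⟩ := (moriModel n α β).toPt_surjective P
  by_cases ht : tCoord p.1 = 0
  swap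
  · exact subset_closure ⟨p, rfl, ht⟩
  have hp := p.2.2.2
  rw [ht] at hp
  simp only [map_mul, map_one, one_mul, ne_eq, OfNat.ofNat_ne_zero, not_false_eq_true, zero_pow,
    mul_zero, zero_add] at hp
  have hx0 : planeCoord p.1 ≠ 0 := fun h0 => p.2.2.1 ⟨h0, ht⟩
  by_cases hαβ : MvPolynomial.eval (lineCoord p.1) α * MvPolynomial.eval (lineCoord p.1) β = 0
  -- Here `αβ = 0` and `f = 0`, so the equation holds for every `t` and only `t` is moved.
  · refine fibration_mem_closure_of_curve h p (.C (MvPolynomial.eval (lineCoord p.1) α))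
      (.C (MvPolynomial.eval (lineCoord p.1) β)) (fun i => .C (planeCoord p.1 i)) .X
      (by simp) (by simp) (by simp) (by simp [ht]) ?_ .X Polynomial.X_ne_zero ?_
    · intro z
      simp only [Polynomial.eval_C, Polynomial.eval_X, map_mul, h.eval_left, h.eval_right,
        map_one, one_mul, hαβ, hp]
      simp
    · intro z hz hzQ
      exact ⟨⟨_, hz⟩, rfl, by simpa [tCoord, coxVec] using hzQ⟩
  -- With `t = z`, move `x` to `x + z²y`, where the derivative of `f` along `y` is `-αβ`. This
  -- cancels `αβt²` to first order in `z²`. The remaining Taylor terms of `f`, in `z⁴`, `z⁶` and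
  -- `z⁸`, are all divisible by `t²` and are absorbed by a correction of `β`.
  · obtain ⟨hα, hβ⟩ := mul_ne_zero_iff.1 hαβ
    obtain ⟨y, hy⟩ := exists_polar_eq hx0
      (-(MvPolynomial.eval (lineCoord p.1) α * MvPolynomial.eval (lineCoord p.1) β))
    generalize hA : MvPolynomial.eval (lineCoord p.1) α = A at *
    generalize hB : MvPolynomial.eval (lineCoord p.1) β = B at *
    generalize hx : planeCoord p.1 = x at *
    rw [eval_kleinQuartic] at hp
    refine fibration_mem_closure_of_curve h p (.C A)
      (.C B - .C (1 / A) * (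
        .C (3 * x 0 * y 0 ^ 2 * x 1 + 3 * x 0 ^ 2 * y 0 * y 1 + 3 * x 1 * y 1 ^ 2 * x 2
          + 3 * x 1 ^ 2 * y 1 * y 2 + 3 * x 2 * y 2 ^ 2 * x 0 + 3 * x 2 ^ 2 * y 2 * y 0) * .X ^ 2
        + .C (y 0 ^ 3 * x 1 + 3 * x 0 * y 0 ^ 2 * y 1 + y 1 ^ 3 * x 2 + 3 * x 1 * y 1 ^ 2 * y 2
          + y 2 ^ 3 * x 0 + 3 * x 2 * y 2 ^ 2 * y 0) * .X ^ 4
        + .C (y 0 ^ 3 * y 1 + y 1 ^ 3 * y 2 + y 2 ^ 3 * y 0) * .X ^ 6))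
      (fun i => .C (x i) + .X ^ 2 * .C (y i)) .X
      (by simp [hA]) (by simp [hB]) (by simp [hx]) (by simp [ht]) ?_ .X Polynomial.X_ne_zero ?_
    · intro z
      simp only [map_mul, h.eval_left, h.eval_right, map_one, one_mul, eval_kleinQuartic,
        Polynomial.eval_C, Polynomial.eval_X, Polynomial.eval_add, Polynomial.eval_sub,
        Polynomial.eval_mul, Polynomial.eval_pow]
      have hinv : A * (1 / A) = 1 := mul_one_div_cancel hα
      generalize 1 / A = k at *
      linear_combination hp + z ^ 2 * hy - z ^ 2 *
        ((3 * x 0 * y 0 ^ 2 * x 1 + 3 * x 0 ^ 2 * y 0 * y 1 + 3 * x 1 * y 1 ^ 2 * x 2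
          + 3 * x 1 ^ 2 * y 1 * y 2 + 3 * x 2 * y 2 ^ 2 * x 0 + 3 * x 2 ^ 2 * y 2 * y 0) * z ^ 2
        + (y 0 ^ 3 * x 1 + 3 * x 0 * y 0 ^ 2 * y 1 + y 1 ^ 3 * x 2 + 3 * x 1 * y 1 ^ 2 * y 2
          + y 2 ^ 3 * x 0 + 3 * x 2 * y 2 ^ 2 * y 0) * z ^ 4
        + (y 0 ^ 3 * y 1 + y 1 ^ 3 * y 2 + y 2 ^ 3 * y 0) * z ^ 6) * hinv
    · intro z hz hzQ
      exact ⟨⟨_, hz⟩, rfl, by simpa [tCoord, coxVec] using hzQ⟩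

/-- The product of the Klein quartic form and its Hessian covariant. -/
def kleinProduct : MvPolynomial (Fin 3) ℂ := kleinQuartic * kleinHessian

/-- The line ends at `(1, 1, 1)`, where `f = 3` and `K = -2`. -/
theorem aeval_line_kleinProduct_ne_zero (x : Fin 3 → ℂ) :
    MvPolynomial.aeval (fun i => (.C (x i) + .X * .C (1 - x i) : Polynomial ℂ)) kleinProduct
      ≠ 0 := by
  intro h0
  have h1 := eval_curve (fun i => (.C (x i) + .X * .C (1 - x i) : Polynomial ℂ)) 1 kleinProduct
  rw [h0] at h1
  simp [kleinProduct, eval_kleinQuartic, eval_kleinHessian] at h1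
  norm_num at h1

/-- From a point with `t ≠ 0`, move `x` towards `(1, 1, 1)` with `t` fixed. One of `α, β` is
nonzero; it is kept constant and the equation is solved for the other. -/
theorem dense_moriModel_kleinProduct (h : IsDual α β r s) :
    Dense ((moriModel n α β).basicOpen
      (MvPolynomial.rename (Sum.inr ∘ Sum.inl) kleinProduct : MvPolynomial CoxIdx ℂ)) := by
  refine dense_closure.1 ((dense_moriModel_tCoord_ne_zero h).mono ?_)
  rintro _ ⟨p, rfl, ht⟩
  have hp := p.2.2.2
  simp only [map_mul, map_one, one_mul] at hp
  have hS : ∀ (z : ℂ) (w : Fin 2 → ℂ) (t : ℂ) (hz : coxVec w (fun i =>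
      (.C (planeCoord p.1 i) + .X * .C (1 - planeCoord p.1 i) : Polynomial ℂ).eval z) t ∈
        fibrationCone (α * β) 1),
      (MvPolynomial.aeval (fun i => (.C (planeCoord p.1 i) + .X * .C (1 - planeCoord p.1 i) :
        Polynomial ℂ)) kleinProduct).eval z ≠ 0 →
      (moriModel n α β).toPt ⟨_, hz⟩ ∈ (moriModel n α β).basicOpen
        (MvPolynomial.rename (Sum.inr ∘ Sum.inl) kleinProduct : MvPolynomial CoxIdx ℂ) := by
    intro z w t hz hQ
    refine ⟨⟨_, hz⟩, rfl, ?_⟩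
    rw [eval_curve] at hQ
    exact (eval_rename_plane _ kleinProduct).symm ▸ hQ
  rcases h.left_or_right_ne_zero p.2.1 with hα | hβ
  · refine fibration_mem_closure_of_curve h p (.C (MvPolynomial.eval (lineCoord p.1) α))
      (.C (-1 / (MvPolynomial.eval (lineCoord p.1) α * tCoord p.1 ^ 2)) *
        MvPolynomial.aeval (fun i => (.C (planeCoord p.1 i) + .X * .C (1 - planeCoord p.1 i) :
          Polynomial ℂ)) kleinQuartic)
      (fun i => .C (planeCoord p.1 i) + .X * .C (1 - planeCoord p.1 i)) (.C (tCoord p.1))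
      (by simp) ?_ (by simp) (by simp) ?_ _ (aeval_line_kleinProduct_ne_zero (planeCoord p.1))
      fun z hz => hS z _ _ hz
    · rw [Polynomial.eval_mul, eval_curve]
      simp only [Polynomial.eval_C, Polynomial.eval_X, Polynomial.eval_add, Polynomial.eval_mul,
        zero_mul, add_zero]
      field_simp
      linear_combination -hp
    · intro z
      simp only [map_mul, h.eval_left, h.eval_right, map_one, one_mul, Polynomial.eval_mul,
        eval_curve, Polynomial.eval_C]
      field_simp
      ring
  · refine fibration_mem_closure_of_curve h p
      (.C (-1 / (MvPolynomial.eval (lineCoord p.1) β * tCoord p.1 ^ 2)) *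
        MvPolynomial.aeval (fun i => (.C (planeCoord p.1 i) + .X * .C (1 - planeCoord p.1 i) :
          Polynomial ℂ)) kleinQuartic)
      (.C (MvPolynomial.eval (lineCoord p.1) β))
      (fun i => .C (planeCoord p.1 i) + .X * .C (1 - planeCoord p.1 i)) (.C (tCoord p.1))
      ?_ (by simp) (by simp) (by simp) ?_ _ (aeval_line_kleinProduct_ne_zero (planeCoord p.1))
      fun z hz => hS z _ _ hz
    · rw [Polynomial.eval_mul, eval_curve]
      simp only [Polynomial.eval_C, Polynomial.eval_X, Polynomial.eval_add, Polynomial.eval_mul,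
        zero_mul, add_zero]
      field_simp
      linear_combination -hp
    · intro z
      simp only [map_mul, h.eval_left, h.eval_right, map_one, one_mul, Polynomial.eval_mul,
        eval_curve, Polynomial.eval_C]
      field_simp
      ring

/-- On this model `β = 0` forces `f = 0`, so the locus `fK ≠ 0` is contained in `β ≠ 0`. -/
theorem dense_moriModel_right (h : IsDual α β r s) :
    Dense ((moriModel n α β).basicOpen
      (MvPolynomial.rename Sum.inl β : MvPolynomial CoxIdx ℂ)) := by
  refine (dense_moriModel_kleinProduct h).mono ?_
  rintro _ ⟨p, rfl, hp⟩
  refine ⟨p, rfl, fun h0 => hp ?_⟩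
  have hpe := p.2.2.2
  have h0' : MvPolynomial.eval (lineCoord p.1) β = 0 := (eval_rename_line _ _).symm.trans h0
  refine (eval_rename_plane _ _).trans ?_
  simp only [map_mul, map_one, one_mul, h0', mul_zero, zero_mul, zero_add] at hpe
  rw [kleinProduct, map_mul, hpe, zero_mul]

theorem dense_singularModel_right (h : IsDual α β r s) :
    Dense ((singularModel α β).basicOpen
      (MvPolynomial.rename Sum.inl β : MvPolynomial CoxIdx ℂ)) := by
  intro P
  obtain ⟨p, rfl⟩ := (singularModel α β).toPt_surjective P
  by_cases hβ : MvPolynomial.eval (lineCoord p.1) β = 0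
  swap
  · exact subset_closure ⟨p, rfl, (eval_rename_line _ _).symm ▸ hβ⟩
  have hα := (h.left_or_right_ne_zero p.2.1).resolve_right (not_not.2 hβ)
  have hp := p.2.2.2
  have ht : tCoord p.1 = 0 := by simpa [hβ, hα] using hp
  have hS : ∀ (w : Fin 2 → ℂ) (x : Fin 3 → ℂ) (t : ℂ) (hz : coxVec w x t ∈ fibrationCone α β),
      MvPolynomial.eval w β ≠ 0 → (singularModel α β).toPt ⟨_, hz⟩ ∈ (singularModel α β).basicOpen
        (MvPolynomial.rename Sum.inl β : MvPolynomial CoxIdx ℂ) := by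
    intro w x t hz hw
    exact ⟨⟨_, hz⟩, rfl, (eval_rename_line _ _).symm ▸ hw⟩
  -- Now `β = t = 0`. If `f = 0`, then `β` moves freely with `t` fixed at `0`; otherwise take `t =
  -- z` and `β = -αz²/f`.
  by_cases hf : MvPolynomial.eval (planeCoord p.1) kleinQuartic = 0
  · refine fibration_mem_closure_of_curve h p (.C (MvPolynomial.eval (lineCoord p.1) α)) .X
      (fun i => .C (planeCoord p.1 i)) 0 (by simp) (by simp [hβ]) (by simp) (by simp [ht]) ?_
      .X Polynomial.X_ne_zero fun z hz hzQ => hS _ _ _ hz ?_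
    · intro z
      simp [hf]
    · rw [h.eval_right]
      exact hzQ
  · have hk : -MvPolynomial.eval (lineCoord p.1) α /
        MvPolynomial.eval (planeCoord p.1) kleinQuartic ≠ 0 := div_ne_zero (neg_ne_zero.2 hα) hf
    refine fibration_mem_closure_of_curve h p (.C (MvPolynomial.eval (lineCoord p.1) α))
      (.C (-MvPolynomial.eval (lineCoord p.1) α / MvPolynomial.eval (planeCoord p.1) kleinQuartic)
        * .X ^ 2)
      (fun i => .C (planeCoord p.1 i)) .X (by simp) (by simp [hβ]) (by simp) (by simp [ht]) ?_
      .X Polynomial.X_ne_zero fun z hz hzQ => hS _ _ _ hz ?_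
    · intro z
      simp only [h.eval_left, h.eval_right, Polynomial.eval_mul, Polynomial.eval_pow,
        Polynomial.eval_C, Polynomial.eval_X]
      field_simp
      ring
    · rw [h.eval_right]
      simp only [Polynomial.eval_mul, Polynomial.eval_pow, Polynomial.eval_C, Polynomial.eval_X]
        at hzQ ⊢
      exact mul_ne_zero hk (pow_ne_zero 2 hzQ)

/-- A polynomial in the coordinates of `ℙ² × ℙ¹` that does not vanish identically does not vanish
on a dense set. -/
theorem dense_planeTimesLine_basicOpen (G : MvPolynomial planeTimesLine.Idx ℂ)
    (q : planeTimesLine.Idx → ℂ) (hq : MvPolynomial.eval q G ≠ 0) :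
    Dense (planeTimesLine.basicOpen G) := by
  intro P
  obtain ⟨p, rfl⟩ := planeTimesLine.toPt_surjective P
  let c : planeTimesLine.Idx → Polynomial ℂ := fun i => .C (p.1 i) + .X * .C (q i - p.1 i)
  have hc0 : ∀ i, (c i).eval 0 = p.1 i := by simp [c]
  have hne : ∀ i, p.1 i ≠ 0 → c i ≠ 0 := by
    intro i hi h0
    apply hi
    rw [← hc0, h0]
    simp
  obtain ⟨i, hi⟩ : ∃ i, p.1 (Sum.inl i) ≠ 0 := by
    by_contra! h0
    exact p.2.1 (funext h0)
  obtain ⟨j, hj⟩ : ∃ j, p.1 (Sum.inr j) ≠ 0 := by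
    by_contra! h0
    exact p.2.2 (funext h0)
  have hG : MvPolynomial.aeval c G ≠ 0 := by
    intro h0
    have h1 := eval_curve c 1 G
    rw [h0] at h1
    apply hq
    simpa [c] using h1.symm
  refine CoordVariety.mem_closure_of_curve p c hc0 (MvPolynomial.aeval c G *
    (c (.inl i) * c (.inr j))) (mul_ne_zero hG (mul_ne_zero (hne _ hi) (hne _ hj))) ?_
  intro z hz
  simp only [Polynomial.eval_mul] at hz
  refine ⟨⟨fun h0 => ?_, fun h0 => ?_⟩, ⟨_, rfl, ?_⟩⟩
  · exact left_ne_zero_of_mul (right_ne_zero_of_mul hz) (congrFun h0 i)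
  · exact right_ne_zero_of_mul (right_ne_zero_of_mul hz) (congrFun h0 j)
  · rw [← eval_curve]
    exact left_ne_zero_of_mul hz

end Density

/-! ### The birational maps -/

section Maps

variable {n : ℕ} {a b α β : MvPolynomial (Fin 2) ℂ} {r s : Fin 2 → ℂ}

theorem fibration_toPt_eq_of_coxVec {n : ℕ} {p q : fibrationCone a b} (l m : ℂˣ)
    (hw : lineCoord q.1 = (l : ℂ) • lineCoord p.1) (hx : planeCoord q.1 = (m : ℂ) • planeCoord p.1)
    (ht : tCoord q.1 = (l : ℂ) ^ (-(n : ℤ)) * (m : ℂ) ^ 2 * tCoord p.1) :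
    (fibration n a b).toPt p = (fibration n a b).toPt q := by
  refine (fibration_toPt_eq_iff p q).2 ⟨l, m, ?_⟩
  rw [torusAct, ← hw, ← hx, ← ht, coxVec_coords]

theorem isSemiInvariant_rename_line (hβ : ∀ (l : ℂ) w,
    MvPolynomial.eval (l • w) β = l * MvPolynomial.eval w β) :
    (fibration n a b).IsSemiInvariant (MvPolynomial.rename Sum.inl β : MvPolynomial CoxIdx ℂ) := by
  intro p q hpq hp
  obtain ⟨l, m, h⟩ := (fibration_toPt_eq_iff p q).1 hpq
  have hp' : MvPolynomial.eval (lineCoord p.1) β ≠ 0 := fun h0 => hp ((eval_rename_line _ _).trans h0)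
  intro h0
  have h1 := (eval_rename_line _ _).symm.trans h0
  rw [h] at h1
  exact mul_ne_zero l.ne_zero hp' ((hβ _ _).symm.trans h1)

theorem eval_kleinProduct_smul (m : ℂ) (p : Fin 3 → ℂ) :
    MvPolynomial.eval (m • p) kleinProduct = m ^ 10 * MvPolynomial.eval p kleinProduct := by
  rw [kleinProduct, map_mul, map_mul, eval_kleinQuartic_smul, eval_kleinHessian_smul]
  ring

theorem isSemiInvariant_rename_plane :
    (fibration n a b).IsSemiInvariant
      (MvPolynomial.rename (Sum.inr ∘ Sum.inl) kleinProduct : MvPolynomial CoxIdx ℂ) := by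
  intro p q hpq hp
  obtain ⟨l, m, h⟩ := (fibration_toPt_eq_iff p q).1 hpq
  have hp' : MvPolynomial.eval (planeCoord p.1) kleinProduct ≠ 0 :=
    fun h0 => hp ((eval_rename_plane _ _).trans h0)
  intro h0
  have h1 := (eval_rename_plane _ _).symm.trans h0
  rw [h] at h1
  exact mul_ne_zero (pow_ne_zero 10 m.ne_zero) hp' ((eval_kleinProduct_smul _ _).symm.trans h1)

/-- The map that multiplies the coordinate `t` by `β`. -/
def mulCoord (β : MvPolynomial (Fin 2) ℂ) : CoxIdx → MvPolynomial CoxIdx ℂ :=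
  Sum.elim (fun i => .X (.inl i)) (Sum.elim (fun i => .X (.inr (.inl i)))
    fun _ => MvPolynomial.rename .inl β * .X (.inr (.inr ())))

theorem polyMap_mulCoord (p : CoxIdx → ℂ) : polyMap (mulCoord β) p =
    coxVec (lineCoord p) (planeCoord p) (MvPolynomial.eval (lineCoord p) β * tCoord p) := by
  ext (i | i | i)
  · simp [polyMap, mulCoord, coxVec, lineCoord]
  · simp [polyMap, mulCoord, coxVec, planeCoord]
  · simp [polyMap, mulCoord, coxVec, eval_rename_line, tCoord]

/-- The inverse of the map that multiplies the coordinate `t` by `β`. -/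
def divCoord (β : MvPolynomial (Fin 2) ℂ) : CoxIdx → MvPolynomial CoxIdx ℂ :=
  Sum.elim (fun i => .X (.inl i)) (Sum.elim
    (fun i => MvPolynomial.rename .inl β * .X (.inr (.inl i)))
    fun _ => MvPolynomial.rename .inl β * .X (.inr (.inr ())))

theorem polyMap_divCoord (p : CoxIdx → ℂ) : polyMap (divCoord β) p =
    coxVec (lineCoord p) (MvPolynomial.eval (lineCoord p) β • planeCoord p)
      (MvPolynomial.eval (lineCoord p) β * tCoord p) := by
  ext (i | i | i)
  · simp [polyMap, divCoord, coxVec, lineCoord]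
  · simp [polyMap, divCoord, coxVec, eval_rename_line, planeCoord]
  · simp [polyMap, divCoord, coxVec, eval_rename_line, tCoord]

theorem mulCoord_mem {p : CoxIdx → ℂ} (hp : p ∈ fibrationCone (α * β) 1)
    (hβ : MvPolynomial.eval (lineCoord p) β ≠ 0) :
    polyMap (mulCoord β) p ∈ fibrationCone α β := by
  rw [polyMap_mulCoord]
  refine ⟨hp.1, fun h0 => hp.2.1 ⟨h0.1, (mul_eq_zero.1 h0.2).resolve_left hβ⟩, ?_⟩
  have h := hp.2.2
  simp only [map_mul, map_one, one_mul] at h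
  change MvPolynomial.eval (lineCoord p) α * (MvPolynomial.eval (lineCoord p) β * tCoord p) ^ 2 +
    MvPolynomial.eval (lineCoord p) β * MvPolynomial.eval (planeCoord p) kleinQuartic = 0
  linear_combination MvPolynomial.eval (lineCoord p) β * h

/-- Dividing `t` by `β` is not polynomial, but the torus element `(1, β)` turns `(x, t/β)` into
`(βx, βt)`. The new equation is `β³` times the old one. -/
theorem divCoord_mem {p : CoxIdx → ℂ} (hp : p ∈ fibrationCone α β)
    (hβ : MvPolynomial.eval (lineCoord p) β ≠ 0) :
    polyMap (divCoord β) p ∈ fibrationCone (α * β) 1 := by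
  rw [polyMap_divCoord]
  refine ⟨hp.1, fun h0 => hp.2.1
    ⟨(smul_eq_zero.1 h0.1).resolve_left hβ, (mul_eq_zero.1 h0.2).resolve_left hβ⟩, ?_⟩
  have h := hp.2.2
  change MvPolynomial.eval (lineCoord p) (α * β) *
    (MvPolynomial.eval (lineCoord p) β * tCoord p) ^ 2 + MvPolynomial.eval (lineCoord p) 1 *
      MvPolynomial.eval (MvPolynomial.eval (lineCoord p) β • planeCoord p) kleinQuartic = 0
  rw [eval_kleinQuartic_smul, map_mul, map_one]
  linear_combination MvPolynomial.eval (lineCoord p) β ^ 3 * h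

theorem toPt_mulCoord_congr (h : IsAdmissible 1 α β) (p q : fibrationCone (α * β) 1)
    (hp : polyMap (mulCoord β) p.1 ∈ fibrationCone α β)
    (hq : polyMap (mulCoord β) q.1 ∈ fibrationCone α β)
    (hpq : (fibration 1 (α * β) 1).toPt p = (fibration 1 (α * β) 1).toPt q) :
    (fibration 0 α β).toPt ⟨_, hp⟩ = (fibration 0 α β).toPt ⟨_, hq⟩ := by
  obtain ⟨l, m, hlm⟩ := (fibration_toPt_eq_iff p q).1 hpq
  refine fibration_toPt_eq_of_coxVec l m ?_ ?_ ?_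
  · simp only [polyMap_mulCoord, hlm]; rfl
  · simp only [polyMap_mulCoord, hlm]; rfl
  · have hl := l.ne_zero
    have hβ := h.eval_smul_right l (lineCoord p.1)
    simp only [polyMap_mulCoord, hlm]
    change MvPolynomial.eval ((l : ℂ) • lineCoord p.1) β * ((l : ℂ) ^ (-((1 : ℕ) : ℤ)) *
      (m : ℂ) ^ 2 * tCoord p.1) = (l : ℂ) ^ (-((0 : ℕ) : ℤ)) * (m : ℂ) ^ 2 *
        (MvPolynomial.eval (lineCoord p.1) β * tCoord p.1)
    rw [hβ]
    simp
    field_simp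

theorem toPt_divCoord_congr (h : IsAdmissible 1 α β) (p q : fibrationCone α β)
    (hp : polyMap (divCoord β) p.1 ∈ fibrationCone (α * β) 1)
    (hq : polyMap (divCoord β) q.1 ∈ fibrationCone (α * β) 1)
    (hpq : (fibration 0 α β).toPt p = (fibration 0 α β).toPt q) :
    (fibration 1 (α * β) 1).toPt ⟨_, hp⟩ = (fibration 1 (α * β) 1).toPt ⟨_, hq⟩ := by
  obtain ⟨l, m, hlm⟩ := (fibration_toPt_eq_iff p q).1 hpq
  have hβ := h.eval_smul_right l (lineCoord p.1)
  -- The extra factor `l` comes from `β` multiplying `x`; on `t` it agrees with the weight, as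
  -- `l⁻¹(lm)² = lm²`.
  refine fibration_toPt_eq_of_coxVec l (l * m) ?_ ?_ ?_
  · simp only [polyMap_divCoord, hlm]; rfl
  · simp only [polyMap_divCoord, hlm]
    change MvPolynomial.eval ((l : ℂ) • lineCoord p.1) β • ((m : ℂ) • planeCoord p.1) =
      ((l * m : ℂˣ) : ℂ) • (MvPolynomial.eval (lineCoord p.1) β • planeCoord p.1)
    rw [hβ, smul_smul, smul_smul, Units.val_mul]
    congr 1
    ring
  · have hl := l.ne_zero
    simp only [polyMap_divCoord, hlm]
    change MvPolynomial.eval ((l : ℂ) • lineCoord p.1) β * ((l : ℂ) ^ (-((0 : ℕ) : ℤ)) *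
      (m : ℂ) ^ 2 * tCoord p.1) = (l : ℂ) ^ (-((1 : ℕ) : ℤ)) * ((l * m : ℂˣ) : ℂ) ^ 2 *
        (MvPolynomial.eval (lineCoord p.1) β * tCoord p.1)
    rw [hβ]
    simp
    field_simp

theorem eval_mulCoord_rename_line (p : CoxIdx → ℂ) :
    MvPolynomial.eval (polyMap (mulCoord β) p) (MvPolynomial.rename Sum.inl β) =
      MvPolynomial.eval p (MvPolynomial.rename Sum.inl β) := by
  rw [eval_rename_line, eval_rename_line, polyMap_mulCoord]
  rfl

theorem eval_divCoord_rename_line (p : CoxIdx → ℂ) :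
    MvPolynomial.eval (polyMap (divCoord β) p) (MvPolynomial.rename Sum.inl β) =
      MvPolynomial.eval p (MvPolynomial.rename Sum.inl β) := by
  rw [eval_rename_line, eval_rename_line, polyMap_divCoord]
  rfl

theorem induces_mulCoord (h : IsAdmissible 1 α β) :
    CoordVariety.Induces (moriModel 1 α β) (singularModel α β) (mulCoord β)
      (MvPolynomial.rename Sum.inl β : MvPolynomial CoxIdx ℂ)
      (MvPolynomial.rename Sum.inl β : MvPolynomial CoxIdx ℂ) where
  isSemiInvariant := isSemiInvariant_rename_line h.eval_smul_right
  mem_cone p hp := mulCoord_mem p.2 fun h0 => hp ((eval_rename_line _ _).trans h0)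
  eval_ne_zero _ hp h0 := hp ((eval_mulCoord_rename_line _).symm.trans h0)
  congr p q hp hq _ hpq := toPt_mulCoord_congr h p q hp hq hpq

theorem induces_divCoord (h : IsAdmissible 1 α β) :
    CoordVariety.Induces (singularModel α β) (moriModel 1 α β) (divCoord β)
      (MvPolynomial.rename Sum.inl β : MvPolynomial CoxIdx ℂ)
      (MvPolynomial.rename Sum.inl β : MvPolynomial CoxIdx ℂ) where
  isSemiInvariant := isSemiInvariant_rename_line h.eval_smul_right
  mem_cone p hp := divCoord_mem p.2 fun h0 => hp ((eval_rename_line _ _).trans h0)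
  eval_ne_zero _ hp h0 := hp ((eval_divCoord_rename_line _).symm.trans h0)
  congr p q hp hq _ hpq := toPt_divCoord_congr h p q hp hq hpq

theorem toPt_divCoord_mulCoord (p : fibrationCone a b)
    (hp : polyMap (divCoord β) (polyMap (mulCoord β) p.1) ∈ fibrationCone a b)
    (hβ : MvPolynomial.eval (lineCoord p.1) β ≠ 0) :
    (fibration n a b).toPt ⟨_, hp⟩ = (fibration n a b).toPt p := by
  refine (fibration_toPt_eq_of_coxVec 1 (Units.mk0 _ hβ) ?_ ?_ ?_).symm
  · simp only [polyMap_divCoord, polyMap_mulCoord, Units.val_one, one_smul]; rfl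
  · simp only [polyMap_divCoord, polyMap_mulCoord]; rfl
  · simp only [polyMap_divCoord, polyMap_mulCoord]
    change MvPolynomial.eval (lineCoord p.1) β *
      (MvPolynomial.eval (lineCoord p.1) β * tCoord p.1) = _
    simp
    ring

theorem toPt_mulCoord_divCoord (p : fibrationCone a b)
    (hp : polyMap (mulCoord β) (polyMap (divCoord β) p.1) ∈ fibrationCone a b)
    (hβ : MvPolynomial.eval (lineCoord p.1) β ≠ 0) :
    (fibration n a b).toPt ⟨_, hp⟩ = (fibration n a b).toPt p := by
  refine (fibration_toPt_eq_of_coxVec 1 (Units.mk0 _ hβ) ?_ ?_ ?_).symm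
  · simp only [polyMap_divCoord, polyMap_mulCoord, Units.val_one, one_smul]; rfl
  · simp only [polyMap_divCoord, polyMap_mulCoord]; rfl
  · simp only [polyMap_divCoord, polyMap_mulCoord]
    change MvPolynomial.eval (lineCoord p.1) β *
      (MvPolynomial.eval (lineCoord p.1) β * tCoord p.1) = _
    simp
    ring

/-! ### Equivariance and birationality of the multiplication by `β`. -/

theorem polyMap_mulCoord_coordAct (A : SL(3, ℂ)) (p : CoxIdx → ℂ) :
    polyMap (mulCoord β) (coordAct A p) = coordAct A (polyMap (mulCoord β) p) := by
  rw [polyMap_mulCoord, polyMap_mulCoord]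
  rfl

theorem eval_rename_line_coordAct (A : SL(3, ℂ)) (p : CoxIdx → ℂ) :
    MvPolynomial.eval (coordAct A p) (MvPolynomial.rename Sum.inl β) =
      MvPolynomial.eval p (MvPolynomial.rename Sum.inl β) := by
  rw [eval_rename_line, eval_rename_line]
  rfl

theorem exists_isBirational_isMulBy (h : IsAdmissible 1 α β) :
    ∃ e : OpenPartialHomeomorph (moriModel 1 α β).Pt (singularModel α β).Pt,
      CoordVariety.IsBirational e ∧
      CoordVariety.IsEquivariant (MonoidHom.id kleinGroup) e ∧ IsMulBy e := by
  obtain ⟨r, s, hd⟩ := h.exists_dual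
  have : Nonempty (moriModel 1 α β).Pt := inferInstanceAs (Nonempty (fibration 1 (α * β) 1).Pt)
  have : Nonempty (singularModel α β).Pt := inferInstanceAs (Nonempty (fibration 0 α β).Pt)
  obtain ⟨e, he, hes, hep⟩ := CoordVariety.exists_isBirational (induces_mulCoord h)
    (induces_divCoord h)
    (fun p hp hpβ => toPt_divCoord_mulCoord p hp fun h0 => hpβ ((eval_rename_line _ _).trans h0))
    (fun q hq hqβ => toPt_mulCoord_divCoord q hq fun h0 => hqβ ((eval_rename_line _ _).trans h0))
    (dense_moriModel_right hd) (dense_singularModel_right hd)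
  refine ⟨e, he, fun A x hx => ?_, fun p hp => ?_⟩
  · rw [hes] at hx ⊢
    obtain ⟨p, rfl, hp⟩ := hx
    have hAp : MvPolynomial.eval (coordAct A p.1)
        (MvPolynomial.rename Sum.inl β : MvPolynomial CoxIdx ℂ) ≠ 0 :=
      fun h0 => hp ((eval_rename_line_coordAct A.1 p.1).symm.trans h0)
    refine ⟨⟨⟨coordAct A p.1, coordAct_mem A p.2⟩, rfl, hAp⟩, ?_⟩
    rw [hep p hp]
    refine (hep ⟨coordAct A p.1, coordAct_mem A p.2⟩ hAp).trans ?_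
    exact congrArg (singularModel α β).toPt (Subtype.ext (polyMap_mulCoord_coordAct A.1 p.1))
  · rw [hes, (induces_mulCoord h).isSemiInvariant.toPt_mem_basicOpen] at hp
    exact ⟨_, polyMap_mulCoord p.1, hep p hp⟩

/-! ### The map to the product -/

/-- The coordinates on the plane. -/
def prodPlane (q : Fin 3 ⊕ Fin 2 → ℂ) : Fin 3 → ℂ := fun i => q (.inl i)

/-- The coordinates on the line. -/
def prodLine (q : Fin 3 ⊕ Fin 2 → ℂ) : Fin 2 → ℂ := fun i => q (.inr i)

/-- The map `(u : v; x : y : z : t) ↦ (x : y : z; β t f : K)`, where `f` is the Klein quartic form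
and `K` its Hessian covariant. -/
def toProduct (β : MvPolynomial (Fin 2) ℂ) : Fin 3 ⊕ Fin 2 → MvPolynomial CoxIdx ℂ :=
  Sum.elim (fun i => .X (.inr (.inl i)))
    ![MvPolynomial.rename .inl β * .X (.inr (.inr ())) *
        MvPolynomial.rename (.inr ∘ .inl) kleinQuartic,
      MvPolynomial.rename (.inr ∘ .inl) kleinHessian]

theorem polyMap_toProduct (p : CoxIdx → ℂ) : polyMap (toProduct β) p =
    Sum.elim (planeCoord p)
      ![MvPolynomial.eval (lineCoord p) β * tCoord p *
          MvPolynomial.eval (planeCoord p) kleinQuartic,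
        MvPolynomial.eval (planeCoord p) kleinHessian] := by
  ext (i | i)
  · simp [polyMap, toProduct, planeCoord]
  · fin_cases i
    · simp [polyMap, toProduct, eval_rename_line, eval_rename_plane, tCoord]
    · simp [polyMap, toProduct, eval_rename_plane]

/-- The product `w₀ w₁ f K`. -/
def scaleFactor : MvPolynomial (Fin 3 ⊕ Fin 2) ℂ :=
  .X (.inr 0) * .X (.inr 1) * MvPolynomial.rename .inl kleinProduct

theorem eval_scaleFactor (q : Fin 3 ⊕ Fin 2 → ℂ) : MvPolynomial.eval q scaleFactor =
    prodLine q 0 * prodLine q 1 * MvPolynomial.eval (prodPlane q) kleinProduct := by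
  rw [scaleFactor, map_mul, map_mul, MvPolynomial.eval_rename, MvPolynomial.eval_X,
    MvPolynomial.eval_X]
  rfl

/-- The inverse of the map to the product. The forms `α` and `β` take the values `-f³ w₁²` and
`w₀² K²`. -/
def ofProduct (r s : Fin 2 → ℂ) : CoxIdx → MvPolynomial (Fin 3 ⊕ Fin 2) ℂ :=
  Sum.elim (fun i => -(MvPolynomial.rename .inl kleinQuartic ^ 3 * .X (.inr 1) ^ 2) * .C (r i)
      + .X (.inr 0) ^ 2 * MvPolynomial.rename .inl kleinHessian ^ 2 * .C (s i))
    (Sum.elim (fun i => scaleFactor * .X (.inl i)) fun _ => scaleFactor)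

theorem polyMap_ofProduct (q : Fin 3 ⊕ Fin 2 → ℂ) : polyMap (ofProduct r s) q =
    coxVec (-(MvPolynomial.eval (prodPlane q) kleinQuartic ^ 3 * prodLine q 1 ^ 2) • r +
        (prodLine q 0 ^ 2 * MvPolynomial.eval (prodPlane q) kleinHessian ^ 2) • s)
      (MvPolynomial.eval q scaleFactor • prodPlane q) (MvPolynomial.eval q scaleFactor) := by
  ext (i | i | i)
  · simp [polyMap, ofProduct, coxVec, MvPolynomial.eval_rename]
    rfl
  · simp [polyMap, ofProduct, coxVec, prodPlane]
  · simp [polyMap, ofProduct, coxVec]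

theorem eval_kleinProduct_ne_zero_iff (x : Fin 3 → ℂ) : MvPolynomial.eval x kleinProduct ≠ 0 ↔
    MvPolynomial.eval x kleinQuartic ≠ 0 ∧ MvPolynomial.eval x kleinHessian ≠ 0 := by
  rw [kleinProduct, map_mul, mul_ne_zero_iff]

theorem ne_zero_of_mem_moriModel {p : CoxIdx → ℂ} (hp : p ∈ fibrationCone (α * β) 1)
    (hf : MvPolynomial.eval (planeCoord p) kleinQuartic ≠ 0) :
    MvPolynomial.eval (lineCoord p) α ≠ 0 ∧ MvPolynomial.eval (lineCoord p) β ≠ 0 ∧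
      tCoord p ≠ 0 := by
  have h := hp.2.2
  simp only [map_mul, map_one, one_mul] at h
  refine ⟨fun h0 => hf ?_, fun h0 => hf ?_, fun h0 => hf ?_⟩ <;> simpa [h0] using h

/-- The admissible coordinate vectors of the product. -/
def prodCone : Set (Fin 3 ⊕ Fin 2 → ℂ) := planeTimesLine.cone

theorem prodCone_toPt_eq_iff (p q : prodCone) :
    planeTimesLine.toPt p = planeTimesLine.toPt q ↔
      ∃ m l : ℂˣ, prodPlane q.1 = (m : ℂ) • prodPlane p.1 ∧
        prodLine q.1 = (l : ℂ) • prodLine p.1 := by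
  refine (planeTimesLine_toPt_eq_iff p q).trans ⟨?_, ?_⟩
  · rintro ⟨⟨m, hm⟩, ⟨l, hl⟩⟩
    exact ⟨m, l, hm.symm, hl.symm⟩
  · rintro ⟨m, l, hm, hl⟩
    exact ⟨⟨m, hm.symm⟩, ⟨l, hl.symm⟩⟩

theorem eval_scaleFactor_toProduct_ne_zero {p : CoxIdx → ℂ} (hp : p ∈ fibrationCone (α * β) 1)
    (hp' : MvPolynomial.eval (planeCoord p) kleinProduct ≠ 0) :
    MvPolynomial.eval (polyMap (toProduct β) p) scaleFactor ≠ 0 := by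
  obtain ⟨hf, hK⟩ := (eval_kleinProduct_ne_zero_iff _).1 hp'
  obtain ⟨-, hβ, ht⟩ := ne_zero_of_mem_moriModel hp hf
  rw [eval_scaleFactor, polyMap_toProduct]
  exact mul_ne_zero (mul_ne_zero (mul_ne_zero (mul_ne_zero hβ ht) hf) hK) hp'

theorem toProduct_mem {p : CoxIdx → ℂ}
    (hp : MvPolynomial.eval (planeCoord p) kleinProduct ≠ 0) :
    polyMap (toProduct β) p ∈ prodCone := by
  obtain ⟨hf, hK⟩ := (eval_kleinProduct_ne_zero_iff _).1 hp
  rw [polyMap_toProduct]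
  refine ⟨fun h0 => hf ?_, fun h0 => hK (congrFun h0 1)⟩
  have h1 : planeCoord p = 0 := h0
  rw [h1, eval_kleinQuartic]
  simp

theorem toPt_toProduct_congr (h : IsAdmissible 1 α β) (p q : fibrationCone (α * β) 1)
    (hp : polyMap (toProduct β) p.1 ∈ prodCone) (hq : polyMap (toProduct β) q.1 ∈ prodCone)
    (hpq : (fibration 1 (α * β) 1).toPt p = (fibration 1 (α * β) 1).toPt q) :
    planeTimesLine.toPt ⟨_, hp⟩ = planeTimesLine.toPt ⟨_, hq⟩ := by
  obtain ⟨l, m, hlm⟩ := (fibration_toPt_eq_iff p q).1 hpq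
  have hβ := h.eval_smul_right l (lineCoord p.1)
  have hl := l.ne_zero
  -- In `βtf` the factors `l` and `l⁻¹` cancel, leaving `m²m⁴`, which matches the degree 6 of `K`.
  refine (prodCone_toPt_eq_iff ⟨_, hp⟩ ⟨_, hq⟩).2 ⟨m, m ^ 6, ?_, ?_⟩
  · simp only [polyMap_toProduct, hlm]; rfl
  · simp only [polyMap_toProduct, hlm]
    change ![MvPolynomial.eval ((l : ℂ) • lineCoord p.1) β *
        ((l : ℂ) ^ (-((1 : ℕ) : ℤ)) * (m : ℂ) ^ 2 * tCoord p.1) *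
          MvPolynomial.eval ((m : ℂ) • planeCoord p.1) kleinQuartic,
        MvPolynomial.eval ((m : ℂ) • planeCoord p.1) kleinHessian] =
      ((m ^ 6 : ℂˣ) : ℂ) • ![MvPolynomial.eval (lineCoord p.1) β * tCoord p.1 *
        MvPolynomial.eval (planeCoord p.1) kleinQuartic,
        MvPolynomial.eval (planeCoord p.1) kleinHessian]
    rw [hβ, eval_kleinQuartic_smul, eval_kleinHessian_smul]
    ext i
    fin_cases i
    · simp
      field_simp
    · simp

theorem induces_toProduct (h : IsAdmissible 1 α β) :
    CoordVariety.Induces (moriModel 1 α β) planeTimesLine (toProduct β)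
      (MvPolynomial.rename (Sum.inr ∘ Sum.inl) kleinProduct : MvPolynomial CoxIdx ℂ)
      scaleFactor where
  isSemiInvariant := isSemiInvariant_rename_plane
  mem_cone _ hp := toProduct_mem fun h0 => hp ((eval_rename_plane _ _).trans h0)
  eval_ne_zero p hp := eval_scaleFactor_toProduct_ne_zero p.2
    fun h0 => hp ((eval_rename_plane _ _).trans h0)
  congr p q hp hq _ hpq := toPt_toProduct_congr h p q hp hq hpq

theorem eval_scaleFactor_of_smul {p q : Fin 3 ⊕ Fin 2 → ℂ} {m l : ℂ}
    (hm : prodPlane q = m • prodPlane p) (hl : prodLine q = l • prodLine p) :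
    MvPolynomial.eval q scaleFactor = l ^ 2 * m ^ 10 * MvPolynomial.eval p scaleFactor := by
  rw [eval_scaleFactor, eval_scaleFactor, hm, hl, eval_kleinProduct_smul]
  simp
  ring

theorem isSemiInvariant_scaleFactor : planeTimesLine.IsSemiInvariant scaleFactor := by
  intro p q hpq hp h0
  obtain ⟨m, l, hm, hl⟩ := (prodCone_toPt_eq_iff p q).1 hpq
  have h1 := (eval_scaleFactor_of_smul hm hl).symm.trans h0
  exact mul_ne_zero (mul_ne_zero (pow_ne_zero 2 l.ne_zero) (pow_ne_zero 10 m.ne_zero)) hp h1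

theorem ofProduct_mem (h : IsDual α β r s) {q : Fin 3 ⊕ Fin 2 → ℂ}
    (hq : MvPolynomial.eval q scaleFactor ≠ 0) :
    polyMap (ofProduct r s) q ∈ fibrationCone (α * β) 1 := by
  have hq' := hq
  rw [eval_scaleFactor] at hq'
  obtain ⟨hf, -⟩ := (eval_kleinProduct_ne_zero_iff _).1 (right_ne_zero_of_mul hq')
  have hw := right_ne_zero_of_mul (left_ne_zero_of_mul hq')
  rw [polyMap_ofProduct]
  refine ⟨h.ne_zero_of_left (neg_ne_zero.2 (mul_ne_zero (pow_ne_zero 3 hf) (pow_ne_zero 2 hw))),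
    fun h0 => hq h0.2, ?_⟩
  change MvPolynomial.eval (_ • r + _ • s) (α * β) * _ ^ 2 + MvPolynomial.eval _ 1 *
    MvPolynomial.eval (MvPolynomial.eval q scaleFactor • prodPlane q) kleinQuartic = 0
  rw [map_mul, h.eval_left, h.eval_right, map_one, eval_kleinQuartic_smul]
  change _ * MvPolynomial.eval q scaleFactor ^ 2 + _ = 0
  rw [eval_scaleFactor, kleinProduct, map_mul]
  ring

theorem eval_kleinProduct_ofProduct_ne_zero {q : Fin 3 ⊕ Fin 2 → ℂ}
    (hq : MvPolynomial.eval q scaleFactor ≠ 0) :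
    MvPolynomial.eval (polyMap (ofProduct r s) q)
      (MvPolynomial.rename (Sum.inr ∘ Sum.inl) kleinProduct) ≠ 0 := by
  have hq' := hq
  rw [eval_scaleFactor] at hq'
  rw [eval_rename_plane, polyMap_ofProduct]
  change MvPolynomial.eval (MvPolynomial.eval q scaleFactor • prodPlane q) kleinProduct ≠ 0
  rw [eval_kleinProduct_smul]
  exact mul_ne_zero (pow_ne_zero 10 hq) (right_ne_zero_of_mul hq')

theorem toPt_ofProduct_congr (p q : prodCone)
    (hp : polyMap (ofProduct r s) p.1 ∈ fibrationCone a b)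
    (hq : polyMap (ofProduct r s) q.1 ∈ fibrationCone a b)
    (hpq : planeTimesLine.toPt p = planeTimesLine.toPt q) :
    (fibration 1 a b).toPt ⟨_, hp⟩ = (fibration 1 a b).toPt ⟨_, hq⟩ := by
  obtain ⟨m, l, hm, hl⟩ := (prodCone_toPt_eq_iff p q).1 hpq
  have hs := eval_scaleFactor_of_smul hm hl
  -- The values of `α` and `β` both scale by `l²m¹²`, and `scaleFactor` by `l²m¹⁰`. The weight of
  -- `t` is consistent: `(l²m¹²)⁻¹(l²m¹¹)² = l²m¹⁰`.
  refine fibration_toPt_eq_of_coxVec (l ^ 2 * m ^ 12) (l ^ 2 * m ^ 11) ?_ ?_ ?_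
  · simp only [polyMap_ofProduct]
    change _ • r + _ • s = _ • (_ • r + _ • s)
    rw [hm, hl, eval_kleinQuartic_smul, eval_kleinHessian_smul, smul_add, smul_smul, smul_smul]
    congr 2 <;> simp <;> ring
  · simp only [polyMap_ofProduct]
    change MvPolynomial.eval q.1 scaleFactor • prodPlane q.1 =
      _ • (MvPolynomial.eval p.1 scaleFactor • prodPlane p.1)
    rw [hs, hm, smul_smul, smul_smul]
    congr 1
    simp
    ring
  · simp only [polyMap_ofProduct]
    change MvPolynomial.eval q.1 scaleFactor = _ * _ * MvPolynomial.eval p.1 scaleFactor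
    rw [hs]
    congr 1
    have hl0 := l.ne_zero
    have hm0 := m.ne_zero
    simp
    field_simp

theorem induces_ofProduct (h : IsDual α β r s) :
    CoordVariety.Induces planeTimesLine (moriModel 1 α β) (ofProduct r s) scaleFactor
      (MvPolynomial.rename (Sum.inr ∘ Sum.inl) kleinProduct : MvPolynomial CoxIdx ℂ) where
  isSemiInvariant := isSemiInvariant_scaleFactor
  mem_cone _ hq := ofProduct_mem h hq
  eval_ne_zero _ hq := eval_kleinProduct_ofProduct_ne_zero hq
  congr p q hp hq _ hpq := toPt_ofProduct_congr p q hp hq hpq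

theorem toPt_ofProduct_toProduct (h : IsDual α β r s) (p : fibrationCone (α * β) 1)
    (hp : polyMap (ofProduct r s) (polyMap (toProduct β) p.1) ∈ fibrationCone (α * β) 1)
    (hp' : MvPolynomial.eval (planeCoord p.1) kleinProduct ≠ 0) :
    (fibration 1 (α * β) 1).toPt ⟨_, hp⟩ = (fibration 1 (α * β) 1).toPt p := by
  obtain ⟨hf, hK⟩ := (eval_kleinProduct_ne_zero_iff _).1 hp'
  obtain ⟨hα, hβ, ht⟩ := ne_zero_of_mem_moriModel p.2 hf
  have heq := p.2.2.2
  simp only [map_mul, map_one, one_mul] at heq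
  have hs : MvPolynomial.eval (polyMap (toProduct β) p.1) scaleFactor =
      MvPolynomial.eval (lineCoord p.1) β * tCoord p.1 *
        (MvPolynomial.eval (planeCoord p.1) kleinQuartic ^ 2 *
          MvPolynomial.eval (planeCoord p.1) kleinHessian ^ 2) := by
    rw [eval_scaleFactor, polyMap_toProduct]
    change MvPolynomial.eval (lineCoord p.1) β * tCoord p.1 *
      MvPolynomial.eval (planeCoord p.1) kleinQuartic *
      MvPolynomial.eval (planeCoord p.1) kleinHessian *
      MvPolynomial.eval (planeCoord p.1) kleinProduct = _
    rw [kleinProduct, map_mul]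
    ring
  have hl : MvPolynomial.eval (lineCoord p.1) β * tCoord p.1 ^ 2 *
      (MvPolynomial.eval (planeCoord p.1) kleinQuartic ^ 2 *
          MvPolynomial.eval (planeCoord p.1) kleinHessian ^ 2) ≠ 0 := by
    simp [hf, hK, hβ, ht]
  have hm := eval_scaleFactor_toProduct_ne_zero p.2 hp'
  -- The torus element is `(βt²f²K², βtf²K²)`. On `α` the match uses the equation in the form `αβt²
  -- = -f`.
  refine (fibration_toPt_eq_of_coxVec (Units.mk0 _ hl) (Units.mk0 _ hm) ?_ ?_ ?_).symm
  · simp only [polyMap_ofProduct, polyMap_toProduct]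
    change -(MvPolynomial.eval (planeCoord p.1) kleinQuartic ^ 3 *
        MvPolynomial.eval (planeCoord p.1) kleinHessian ^ 2) • r +
      ((MvPolynomial.eval (lineCoord p.1) β * tCoord p.1 *
        MvPolynomial.eval (planeCoord p.1) kleinQuartic) ^ 2 *
        MvPolynomial.eval (planeCoord p.1) kleinHessian ^ 2) • s = _ • lineCoord p.1
    conv_rhs => arg 2; rw [← h.eq (lineCoord p.1)]
    rw [smul_add, smul_smul, smul_smul, Units.val_mk0]
    congr 2
    · linear_combination (-MvPolynomial.eval (planeCoord p.1) kleinQuartic ^ 2 *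
        MvPolynomial.eval (planeCoord p.1) kleinHessian ^ 2) * heq
    · ring
  · simp only [polyMap_ofProduct, Units.val_mk0]
    change _ • prodPlane (polyMap (toProduct β) p.1) = _
    rw [polyMap_toProduct]
    rfl
  · simp only [polyMap_ofProduct]
    change MvPolynomial.eval (polyMap (toProduct β) p.1) scaleFactor = _ * _ * tCoord p.1
    simp only [Units.val_mk0, hs]
    simp
    field_simp

theorem toPt_toProduct_ofProduct (h : IsDual α β r s) (q : prodCone)
    (hq : polyMap (toProduct β) (polyMap (ofProduct r s) q.1) ∈ prodCone)
    (hq' : MvPolynomial.eval q.1 scaleFactor ≠ 0) :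
    planeTimesLine.toPt ⟨_, hq⟩ = planeTimesLine.toPt q := by
  have hsf : MvPolynomial.eval q.1 scaleFactor = prodLine q.1 0 * prodLine q.1 1 *
      (MvPolynomial.eval (prodPlane q.1) kleinQuartic *
        MvPolynomial.eval (prodPlane q.1) kleinHessian) := by
    rw [eval_scaleFactor, kleinProduct, map_mul]
  have hq'' := hq'
  rw [hsf] at hq''
  have hK := right_ne_zero_of_mul (right_ne_zero_of_mul hq'')
  have hw1 := right_ne_zero_of_mul (left_ne_zero_of_mul hq'')
  -- With `S = w₀w₁fK`, the composite has line coordinates `S⁵w₀²K²f` and `S⁶K`, which are `S⁶K/w₁`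
  -- times `w₀` and `w₁`.
  have hl : MvPolynomial.eval q.1 scaleFactor ^ 6 / prodLine q.1 1 *
      MvPolynomial.eval (prodPlane q.1) kleinHessian ≠ 0 :=
    mul_ne_zero (div_ne_zero (pow_ne_zero 6 hq') hw1) hK
  refine ((prodCone_toPt_eq_iff q ⟨_, hq⟩).2 ⟨Units.mk0 _ hq', Units.mk0 _ hl, ?_, ?_⟩).symm
  · simp only [polyMap_ofProduct, polyMap_toProduct]; rfl
  · simp only [polyMap_ofProduct, polyMap_toProduct, Units.val_mk0]
    change ![MvPolynomial.eval (_ • r + _ • s) β * MvPolynomial.eval q.1 scaleFactor *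
        MvPolynomial.eval (MvPolynomial.eval q.1 scaleFactor • prodPlane q.1) kleinQuartic,
      MvPolynomial.eval (MvPolynomial.eval q.1 scaleFactor • prodPlane q.1) kleinHessian] = _
    rw [h.eval_right, eval_kleinQuartic_smul, eval_kleinHessian_smul]
    ext i
    fin_cases i
    · simp
      field_simp
      rw [hsf]
      ring
    · simp
      field_simp

/-! ### Equivariance and birationality of the map to the product. -/

theorem eval_rename_plane_coordAct (A : kleinGroup) (p : CoxIdx → ℂ) :
    MvPolynomial.eval (coordAct A p) (MvPolynomial.rename (Sum.inr ∘ Sum.inl) kleinProduct) =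
      MvPolynomial.eval p (MvPolynomial.rename (Sum.inr ∘ Sum.inl) kleinProduct) := by
  rw [eval_rename_plane, eval_rename_plane, kleinProduct, map_mul, map_mul]
  exact congrArg₂ _ (A.2 _) (eval_kleinHessian_group_smul A _)

theorem polyMap_toProduct_coordAct (A : kleinGroup) (p : CoxIdx → ℂ) :
    polyMap (toProduct β) (coordAct A p) =
      Sum.elim ((A : SL(3, ℂ)) • prodPlane (polyMap (toProduct β) p))
        (prodLine (polyMap (toProduct β) p)) := by
  rw [polyMap_toProduct, polyMap_toProduct]
  change Sum.elim ((A : SL(3, ℂ)) • planeCoord p)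
    ![MvPolynomial.eval (lineCoord p) β * tCoord p *
      MvPolynomial.eval ((A : SL(3, ℂ)) • planeCoord p) kleinQuartic,
      MvPolynomial.eval ((A : SL(3, ℂ)) • planeCoord p) kleinHessian] = _
  rw [A.2, eval_kleinHessian_group_smul]
  rfl

theorem smul_prodCone_toPt (A : kleinGroup) (q q' : prodCone)
    (h : q'.1 = Sum.elim ((A : SL(3, ℂ)) • prodPlane q.1) (prodLine q.1)) :
    planeTimesLine.toPt q' = A • planeTimesLine.toPt q := by
  obtain ⟨q', hq'⟩ := q'
  subst h
  rfl

theorem exists_isBirational_planeTimesLine (h : IsAdmissible 1 α β) :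
    ∃ e : OpenPartialHomeomorph (moriModel 1 α β).Pt planeTimesLine.Pt,
      CoordVariety.IsBirational e ∧
      CoordVariety.IsEquivariant (MonoidHom.id kleinGroup) e := by
  obtain ⟨r, s, hd⟩ := h.exists_dual
  have : Nonempty (moriModel 1 α β).Pt := inferInstanceAs (Nonempty (fibration 1 (α * β) 1).Pt)
  have hone : MvPolynomial.eval 1 scaleFactor ≠ 0 := by
    rw [eval_scaleFactor, kleinProduct, map_mul, eval_kleinQuartic, eval_kleinHessian]
    simp [prodLine, prodPlane]
    norm_num
  obtain ⟨e, he, hes, hep⟩ := CoordVariety.exists_isBirational (induces_toProduct h)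
    (induces_ofProduct hd)
    (fun p hp hpF => toPt_ofProduct_toProduct hd p hp
      fun h0 => hpF ((eval_rename_plane _ _).trans h0))
    (fun q hq hqG => toPt_toProduct_ofProduct hd q hq hqG)
    (dense_moriModel_kleinProduct hd) (dense_planeTimesLine_basicOpen _ 1 hone)
  refine ⟨e, he, fun A x hx => ?_⟩
  rw [hes] at hx ⊢
  obtain ⟨p, rfl, hp⟩ := hx
  have hAp : MvPolynomial.eval (coordAct A p.1)
      (MvPolynomial.rename (Sum.inr ∘ Sum.inl) kleinProduct : MvPolynomial CoxIdx ℂ) ≠ 0 :=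
    fun h0 => hp ((eval_rename_plane_coordAct A p.1).symm.trans h0)
  refine ⟨⟨⟨coordAct A p.1, coordAct_mem A p.2⟩, rfl, hAp⟩, ?_⟩
  rw [hep p hp]
  refine (hep ⟨coordAct A p.1, coordAct_mem A p.2⟩ hAp).trans ?_
  exact smul_prodCone_toPt A _ _ (polyMap_toProduct_coordAct A p.1)

end Maps

end KleinFibration

end

theorem mainTheorem1 (α β : MvPolynomial (Fin 2) ℂ) (hαβ : KleinFibration.IsAdmissible 1 α β)
    (ρ : PSL(2, ZMod 7) →* KleinFibration.kleinGroup) (hρ : Function.Injective ρ) :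
    (∃ e : OpenPartialHomeomorph (KleinFibration.moriModel 1 α β).Pt
        (KleinFibration.singularModel α β).Pt,
      KleinFibration.CoordVariety.IsBirational e ∧
      KleinFibration.CoordVariety.IsEquivariant ρ e ∧ KleinFibration.IsMulBy e) ∧
    (∃ e : OpenPartialHomeomorph (KleinFibration.moriModel 1 α β).Pt
        KleinFibration.planeTimesLine.Pt,
      KleinFibration.CoordVariety.IsBirational e ∧
      KleinFibration.CoordVariety.IsEquivariant ρ e) := by
  obtain ⟨e, he, heq, hmul⟩ := KleinFibration.exists_isBirational_isMulBy hαβ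
  obtain ⟨e', he', heq'⟩ := KleinFibration.exists_isBirational_planeTimesLine hαβ
  -- Equivariance for the whole `kleinGroup` restricts along `ρ`.
  exact ⟨⟨e, he, fun g => heq (ρ g), hmul⟩, ⟨e', he', fun g => heq' (ρ g)⟩⟩
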